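/- Let $K$ be a field of characteristic zero. A *graph* $\Gamma=(H,V,E,\varphi_V,\varphi_E)$ consists of finite sets $H,V,E$ of half-edges, vertices and edges, with $V\neq\emptyset$, and surjective maps $\varphi_V:H\to V$, $\varphi_E:H\to E$ such that all fibres of $\varphi_E$ have exactly two elements (loops, multiple edges and disconnected graphs are allowed). The valence of a vertex $v$ is $|\varphi_V^{-1}(v)|\ge 1$. A *ribbon graph* is a graph with a cyclic ordering on each fibre of $\varphi_V$. An *orientation* of a graph is an ordering of $H$, an ordering of $V$ and a sign, modulo the relation that a transposition in either ordering changes the sign; isomorphisms of oriented (ribbon) graphs preserve all the structure. For an edge $e=\{h_1,h_2\}$ which is not a loop, with endpoints $v_1\ne v_2$ (where $h_i$ is attached to $v_i$), the contraction $d_e\Gamma$ is the graph obtained by removing $e,h_1,h_2$ and identifying $v_1$ and $v_2$ to a vertex $v$; in the ribbon case, if the cyclic orderings at $v_1,v_2$ are $(a_1,\dots,a_i=h_1)$ and $(b_1,\dots,b_j=h_2)$, the one at $v$ is $(a_1,\dots,a_{i-1},b_1,\dots,b_{j-1})$; and the orientation $(h_1,h_2,p_1,\dots,p_r;\,v_1,v_2,w_1,\dots,w_s)$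 induces $(p_1,\dots,p_r;\,v,w_1,\dots,w_s)$ with the same sign. Put $d_e\Gamma=0$ if $e$ is a loop, or if the contraction would produce a vertex of valence zero (i.e. if $e$ is a connected component of $\Gamma$ consisting of one edge with two univalent endpoints). Let $\widetilde{\mathcal G}$ (respectively $\widetilde{\mathcal G_r}$), the curved (ribbon) graph complex, be the space of possibly infinite $K$-linear combinations of isomorphism classes of oriented graphs (respectively oriented ribbon graphs), modulo the relation that a graph is the negative of the same graph with the opposite orientation; that is, the completion with respect to the number of edges, the product over $m$ of the spaces spanned by graphs with $m$ edges. Its differential is $d\Gamma=\sum_{e\in E_\Gamma}d_e\Gamma$. Let $\mathcal G\subset\widetilde{\mathcal G}$ and $\mathcal G_r\subset\widetilde{\mathcal G_r}$, Kontsevich's graph complex and ribbon graph complex, be the subcomplexes of possibly infinite linear combinations of graphs all of whose vertices have valence $\ge 2$. Then the inclusions $(\mathcal G_r,d)\subset(\widetilde{\mathcal G_r},d)$ and $(\mathcal G,d)\subset(\widetilde{\mathcal G},d)$ induce the zero maps on homology. -/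

import Mathlib

/-!
# Graph complexes with vertices of valence one (curved) and without (uncurved)
-/

namespace CurvedGraph

noncomputable section

open scoped Classical
open Equiv (swap Perm)

/-- A (total) ordering of the elements of a finite set `X`: a list of all of them, without
repetition. -/
@[ext] structure TotalOrdering (X : Type) where
  toList : List X
  nodup : toList.Nodup
  complete : ∀ x, x ∈ toList

namespace TotalOrdering

/-- Transport of an ordering along a bijection. -/
def map {X Y : Type} (e : X ≃ Y) (l : TotalOrdering X) : TotalOrdering Y where
  toList := l.toList.map e
  nodup := l.nodup.map e.injective
  complete y := List.mem_map.2 ⟨e.symm y, l.complete _, by simp⟩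

/-- The ordering of `X` which starts with `a` and continues with a given ordering of the other
elements. -/
def cons {X : Type} (a : X) (l : TotalOrdering {x : X // x ≠ a}) : TotalOrdering X where
  toList := a :: l.toList.map Subtype.val
  nodup := by
    refine List.nodup_cons.2 ⟨?_, l.nodup.map Subtype.val_injective⟩
    simp
  complete x := by
    by_cases hx : x = a
    · simp [hx]
    · exact List.mem_cons_of_mem _ (List.mem_map.2 ⟨⟨x, hx⟩, l.complete _, rfl⟩)

lemma cons_map {X Y : Type} (e : X ≃ Y) {a : X} {b : Y} (f : {x // x ≠ a} ≃ {y // y ≠ b})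
    (hab : e a = b) (hf : ∀ x, (f x).1 = e x.1) (w : TotalOrdering {x // x ≠ a}) :
    cons b (w.map f) = (cons a w).map e := by
  ext1
  simp [cons, map, hab, hf]

end TotalOrdering

lemma val_swap {X : Type} {p : X → Prop} {_ : DecidableEq {x // p x}} (x y z : {x // p x}) :
    (swap x y z).1 = swap x.1 y.1 z.1 :=
  (Subtype.val_injective.swap_apply x y z).symm

/-- A (finite, nonempty) graph: half-edges, vertices and edges, each half-edge being attached to a
vertex and belonging to an edge, such that every vertex has at least one half-edge and every edge
consists of exactly two half-edges. Loops and multiple edges are allowed; the graph need not be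
connected. -/
structure Graph where
  H : Type
  V : Type
  E : Type
  finite_H : Finite H
  nonempty_V : Nonempty V
  φV : H → V
  φE : H → E
  φV_surj : Function.Surjective φV
  φE_surj : Function.Surjective φE
  φE_fiber : ∀ e, (φE ⁻¹' {e}).ncard = 2

namespace Graph

instance (Γ : Graph) : Finite Γ.H := Γ.finite_H

instance (Γ : Graph) : Finite Γ.E := Finite.of_surjective _ Γ.φE_surj

instance (Γ : Graph) : Fintype Γ.E := Fintype.ofFinite _

/-- The valence of a vertex: the number of half-edges attached to it. -/
def valence (Γ : Graph) (v : Γ.V) : ℕ := (Γ.φV ⁻¹' {v}).ncard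

lemma exists_other (Γ : Graph) (h : Γ.H) : ∃ h', h' ≠ h ∧ Γ.φE h' = Γ.φE h := by
  obtain ⟨x, y, hxy, hs⟩ := Set.ncard_eq_two.1 (Γ.φE_fiber (Γ.φE h))
  have hh : h ∈ Γ.φE ⁻¹' {Γ.φE h} := rfl
  have hx : x ∈ Γ.φE ⁻¹' {Γ.φE h} := by rw [hs]; simp
  have hy : y ∈ Γ.φE ⁻¹' {Γ.φE h} := by rw [hs]; simp
  rw [hs] at hh
  rcases hh with rfl | rfl
  · exact ⟨y, hxy.symm, hy⟩
  · exact ⟨x, hxy, hx⟩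

/-- The other half of the edge to which the half-edge `h` belongs. -/
def flip (Γ : Graph) (h : Γ.H) : Γ.H := (Γ.exists_other h).choose

lemma flip_ne (Γ : Graph) (h : Γ.H) : Γ.flip h ≠ h := (Γ.exists_other h).choose_spec.1

lemma φE_flip (Γ : Graph) (h : Γ.H) : Γ.φE (Γ.flip h) = Γ.φE h :=
  (Γ.exists_other h).choose_spec.2

lemma eq_or_eq_flip (Γ : Graph) {h x : Γ.H} (hx : Γ.φE x = Γ.φE h) : x = h ∨ x = Γ.flip h := by
  obtain ⟨a, b, -, hs⟩ := Set.ncard_eq_two.1 (Γ.φE_fiber (Γ.φE h))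
  have h1 : h ∈ Γ.φE ⁻¹' {Γ.φE h} := rfl
  have h2 : x ∈ Γ.φE ⁻¹' {Γ.φE h} := hx
  have h3 : Γ.flip h ∈ Γ.φE ⁻¹' {Γ.φE h} := Γ.φE_flip h
  have h4 := Γ.flip_ne h
  rw [hs] at h1 h2 h3
  simp only [Set.mem_insert_iff, Set.mem_singleton_iff] at h1 h2 h3
  grind

lemma flip_flip (Γ : Graph) (h : Γ.H) : Γ.flip (Γ.flip h) = h := by
  have h1 := Γ.flip_ne (Γ.flip h)
  have h2 := Γ.eq_or_eq_flip (h := h) (x := Γ.flip (Γ.flip h)) (by rw [φE_flip, φE_flip])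
  tauto

lemma flip_unique (Γ : Graph) {h x : Γ.H} (hx : Γ.φE x = Γ.φE h) (hne : x ≠ h) :
    x = Γ.flip h := (Γ.eq_or_eq_flip hx).resolve_left hne

/-- The edge of `h` can be contracted: it is not a loop, and its contraction does not produce a
vertex of valence zero. -/
def Contractible (Γ : Graph) (h : Γ.H) : Prop :=
  Γ.φV h ≠ Γ.φV (Γ.flip h) ∧
    ∃ x, Γ.φE x ≠ Γ.φE h ∧ (Γ.φV x = Γ.φV h ∨ Γ.φV x = Γ.φV (Γ.flip h))

/-- The set of vertices of the graph in which the end points `v₁ = φV h` and `v₂ = φV (flip h)`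
are identified: `v₂` is dropped and `v₁` stands for the new vertex. -/
abbrev MergedV (Γ : Graph) (h : Γ.H) : Type := {v : Γ.V // v ≠ Γ.φV (Γ.flip h)}

/-- The quotient map which identifies the end points of the (non-loop) edge of `h`. -/
def merge (Γ : Graph) (h : Γ.H) (hl : Γ.φV h ≠ Γ.φV (Γ.flip h)) (v : Γ.V) : Γ.MergedV h :=
  if hv : v = Γ.φV (Γ.flip h) then ⟨Γ.φV h, hl⟩ else ⟨v, hv⟩

lemma merge_val (Γ : Graph) (h : Γ.H) (hl : Γ.φV h ≠ Γ.φV (Γ.flip h)) (v : Γ.V) :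
    (Γ.merge h hl v).1 = if v = Γ.φV (Γ.flip h) then Γ.φV h else v := by
  unfold merge
  split_ifs <;> rfl

lemma merge_apply (Γ : Graph) (h : Γ.H) (hl : Γ.φV h ≠ Γ.φV (Γ.flip h)) {Y : Type} {f : Γ.V → Y}
    (hf : Function.Injective f) (v : Γ.V) : f (Γ.merge h hl v).1 =
      if f v = f (Γ.φV (Γ.flip h)) then f (Γ.φV h) else f v := by
  rw [merge_val, apply_ite f]
  simp only [hf.eq_iff]

/-- The half-edges which remain after the contraction of the edge of `h`. -/
abbrev RestH (Γ : Graph) (h : Γ.H) : Type := {x : Γ.H // Γ.φE x ≠ Γ.φE h}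

/-- The contraction of the edge of `h`: the edge disappears and its end points are identified. -/
def contract (Γ : Graph) (h : Γ.H) (hc : Γ.Contractible h) : Graph where
  H := Γ.RestH h
  V := Γ.MergedV h
  E := {e : Γ.E // e ≠ Γ.φE h}
  finite_H := inferInstance
  nonempty_V := ⟨⟨Γ.φV h, hc.1⟩⟩
  φV x := Γ.merge h hc.1 (Γ.φV x)
  φE x := ⟨Γ.φE x, x.2⟩
  φV_surj := by
    rintro ⟨v, hv⟩
    by_cases hv1 : v = Γ.φV h
    · obtain ⟨x, hx, hx'⟩ := hc.2
      refine ⟨⟨x, hx⟩, Subtype.ext ?_⟩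
      rw [merge_val]
      grind
    · obtain ⟨x, rfl⟩ := Γ.φV_surj v
      refine ⟨⟨x, fun hx => ?_⟩, ?_⟩
      · rcases Γ.eq_or_eq_flip hx with rfl | rfl
        · exact hv1 rfl
        · exact hv rfl
      · exact Subtype.ext (by rw [merge_val, if_neg hv])
  φE_surj := by
    rintro ⟨e, he⟩
    obtain ⟨x, rfl⟩ := Γ.φE_surj e
    exact ⟨⟨x, he⟩, rfl⟩
  φE_fiber := by
    rintro ⟨e, he⟩
    rw [← Γ.φE_fiber e, ← Set.ncard_image_of_injective _ (Subtype.val_injective)]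
    congr 1
    ext x
    simp only [Set.mem_image, Set.mem_preimage, Set.mem_singleton_iff, Subtype.mk.injEq,
      Subtype.exists, exists_and_left, exists_prop, exists_eq_right_right]
    constructor
    · rintro ⟨h1, -⟩
      exact h1
    · intro h1
      exact ⟨h1, h1 ▸ he⟩

lemma contract_flip (Γ : Graph) (h : Γ.H) (hc : Γ.Contractible h) (x : Γ.RestH h) :
    ((Γ.contract h hc).flip x).1 = Γ.flip x.1 := by
  apply Γ.flip_unique
  · exact congrArg Subtype.val ((Γ.contract h hc).φE_flip x)
  · exact fun hh => (Γ.contract h hc).flip_ne x (Subtype.ext hh)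

lemma two_le_valence_contract (Γ : Graph) (h : Γ.H) (hc : Γ.Contractible h)
    (hv : ∀ v, 2 ≤ Γ.valence v) (v : (Γ.contract h hc).V) : 2 ≤ (Γ.contract h hc).valence v := by
  have key : ∀ x y : Γ.H, Γ.φE x ≠ Γ.φE h → Γ.φE y ≠ Γ.φE h → x ≠ y →
      (Γ.merge h hc.1 (Γ.φV x)).1 = v.1 → (Γ.merge h hc.1 (Γ.φV y)).1 = v.1 →
      2 ≤ (Γ.contract h hc).valence v := fun x y hx hy hxy h1 h2 =>
    (Set.one_lt_ncard (Set.toFinite _)).2 ⟨⟨x, hx⟩, Subtype.ext h1, ⟨y, hy⟩, Subtype.ext h2,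
      fun h3 => hxy (congrArg Subtype.val h3)⟩
  have two : ∀ u, ∃ x y, Γ.φV x = u ∧ Γ.φV y = u ∧ x ≠ y := fun u => by
    obtain ⟨x, hx, y, hy, hxy⟩ := (Set.one_lt_ncard (Set.toFinite _)).1 (hv u)
    exact ⟨x, y, hx, hy, hxy⟩
  have hE : ∀ x, Γ.φE x = Γ.φE h → x = h ∨ x = Γ.flip h := fun x => Γ.eq_or_eq_flip
  have other : ∀ a, ∃ x, x ≠ a ∧ Γ.φV x = Γ.φV a := fun a => by
    obtain ⟨x, y, hx, hy, hxy⟩ := two (Γ.φV a)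
    by_cases hxa : x = a
    · exact ⟨y, fun hya => hxy (hxa.trans hya.symm), hy⟩
    · exact ⟨x, hxa, hx⟩
  have hne := hc.1
  have hv2 : v.1 ≠ Γ.φV (Γ.flip h) := v.2
  by_cases h1 : v.1 = Γ.φV h
  · obtain ⟨x, hx, hx'⟩ := other h
    obtain ⟨y, hy, hy'⟩ := other (Γ.flip h)
    refine key x y ?_ ?_ ?_ ?_ ?_
    · intro hh
      rcases hE x hh with rfl | rfl
      · exact hx rfl
      · exact hne hx'.symm
    · intro hh
      rcases hE y hh with rfl | rfl
      · exact hne hy'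
      · exact hy rfl
    · rintro rfl
      exact hne (hx'.symm.trans hy')
    · rw [merge_val, hx', if_neg hne, h1]
    · rw [merge_val, hy', if_pos rfl, h1]
  · obtain ⟨x, y, hx, hy, hxy⟩ := two v.1
    refine key x y ?_ ?_ hxy ?_ ?_
    · intro hh
      rcases hE x hh with rfl | rfl
      · exact h1 hx.symm
      · exact hv2 hx.symm
    · intro hh
      rcases hE y hh with rfl | rfl
      · exact h1 hy.symm
      · exact hv2 hy.symm
    · rw [merge_val, hx, if_neg hv2]
    · rw [merge_val, hy, if_neg hv2]

/-- An orientation of a graph, i.e. an ordering of the half-edges, an ordering of the vertices and a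
sign, modulo the relation that a transposition in one of the orderings changes the sign. Such a
class is recorded by the function `sign`: the orientation is the class of `(l, w, sign l w)`, for
every choice of the orderings `l` and `w`. -/
@[ext] structure Orientation (Γ : Graph) where
  sign : TotalOrdering Γ.H → TotalOrdering Γ.V → ℤˣ
  swap_H : ∀ (x y : Γ.H), x ≠ y → ∀ l w, sign (l.map (swap x y)) w = -sign l w
  swap_V : ∀ (x y : Γ.V), x ≠ y → ∀ l w, sign l (w.map (swap x y)) = -sign l w

/-- The opposite orientation. -/
def Orientation.opp {Γ : Graph} (o : Γ.Orientation) : Γ.Orientation where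
  sign l w := -o.sign l w
  swap_H x y hxy l w := by rw [o.swap_H x y hxy]
  swap_V x y hxy l w := by rw [o.swap_V x y hxy]

/-- The ordering `h, flip h, l` of the half-edges of `Γ`. -/
def extendH (Γ : Graph) (h : Γ.H) (l : TotalOrdering (Γ.RestH h)) : TotalOrdering Γ.H where
  toList := h :: Γ.flip h :: l.toList.map Subtype.val
  nodup := by
    have h1 := Γ.flip_ne h
    have h2 := Γ.φE_flip h
    refine List.nodup_cons.2 ⟨?_, List.nodup_cons.2 ⟨?_, l.nodup.map Subtype.val_injective⟩⟩
    · simp [h1.symm]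
    · simp [h2]
  complete x := by
    by_cases hx : Γ.φE x = Γ.φE h
    · rcases Γ.eq_or_eq_flip hx with rfl | rfl <;> simp
    · exact List.mem_cons_of_mem _ (List.mem_cons_of_mem _
        (List.mem_map.2 ⟨⟨x, hx⟩, l.complete _, rfl⟩))

lemma extendH_map {Γ Δ : Graph} (e : Γ.H ≃ Δ.H) {h : Γ.H} {h' : Δ.H}
    (f : Γ.RestH h ≃ Δ.RestH h') (h1 : e h = h') (h2 : e (Γ.flip h) = Δ.flip h')
    (hf : ∀ x, (f x).1 = e x.1) (l : TotalOrdering (Γ.RestH h)) :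
    Δ.extendH h' (l.map f) = (Γ.extendH h l).map e := by
  ext1
  simp [extendH, TotalOrdering.map, h1, h2, hf]

/-- The orientation induced on the contraction. With `h₁ = h`, `h₂ = flip h` and end points
`v₁`, `v₂`, the orientation `(h₁, h₂, l ; v₁, v₂, w)` induces `(l ; v, w)`, where the new vertex `v`
is represented by `v₁`. For an ordering `w'` of `V \ {v₂}` we use `(v₂, w')` with the opposite sign,
which for `w' = (v₁, w)` is the same as `(v₁, v₂, w)`. -/
def Orientation.contract {Γ : Graph} (o : Γ.Orientation) (h : Γ.H) (hc : Γ.Contractible h) :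
    (Γ.contract h hc).Orientation where
  sign l w := -o.sign (Γ.extendH h l) (TotalOrdering.cons (Γ.φV (Γ.flip h)) w)
  swap_H x y hxy l w := by
    have hxy' : x.1 ≠ y.1 := fun hh => hxy (Subtype.ext hh)
    have hx := x.2
    have hy := y.2
    have h2 := Γ.φE_flip h
    have := extendH_map (Δ := Γ) (swap x.1 y.1) (h := h) (h' := h)
      (swap x y : Perm (Γ.contract h hc).H)
      (Equiv.swap_apply_of_ne_of_ne (by grind) (by grind))
      (Equiv.swap_apply_of_ne_of_ne (by grind) (by grind))
      (fun z => val_swap x y z) l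
    exact congrArg Neg.neg ((congrArg (fun L => o.sign L _) this).trans
      (o.swap_H x.1 y.1 hxy' _ _))
  swap_V x y hxy l w := by
    have hxy' : x.1 ≠ y.1 := fun hh => hxy (Subtype.ext hh)
    have := TotalOrdering.cons_map (swap x.1 y.1) (swap x y : Perm (Γ.contract h hc).V)
      (Equiv.swap_apply_of_ne_of_ne x.2.symm y.2.symm)
      (fun z => val_swap x y z) w
    exact congrArg Neg.neg ((congrArg (fun L => o.sign _ L) this).trans
      (o.swap_V x.1 y.1 hxy' _ _))

end Graph

/-! ### Cyclic orderings -/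

section Perm

variable {X : Type}

/-- The permutation obtained by dropping `a` from its cycle (and fixing it). -/
def skip (π : Perm X) (a : X) : Perm X := swap a (π a) * π

lemma skip_apply (π : Perm X) {a x : X} (hx : x ≠ a) :
    skip π a x = if π x = a then π a else π x := by
  have : π x ≠ π a := fun hh => hx (π.injective hh)
  simp only [skip, Perm.mul_apply, Equiv.swap_apply_def]
  grind

lemma skip_self (π : Perm X) (a : X) : skip π a a = a := by simp [skip]

lemma sameCycle_le [Finite X] {σ : Perm X} {r : X → X → Prop} (hr : Equivalence r)
    (h : ∀ x, r x (σ x)) {x y : X} (hxy : σ.SameCycle x y) : r x y := by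
  obtain ⟨i, -, rfl⟩ := hxy.exists_pow_eq'
  clear hxy
  induction i with
  | zero => exact hr.refl _
  | succ n ih => rw [pow_succ', Perm.mul_apply]; exact hr.trans ih (h _)

lemma sameCycle_step (σ : Perm X) (x : X) : σ.SameCycle x (σ x) :=
  Perm.sameCycle_apply_right.2 (Perm.SameCycle.refl _ _)

lemma sameCycle_equivalence (σ : Perm X) : Equivalence σ.SameCycle :=
  ⟨Perm.SameCycle.refl σ, fun h => h.symm, fun h h' => h.trans h'⟩

lemma sameCycle_skip [Finite X] (π : Perm X) {a x y : X} (hx : x ≠ a) (hy : y ≠ a) :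
    (skip π a).SameCycle x y ↔ π.SameCycle x y := by
  constructor
  · refine sameCycle_le (sameCycle_equivalence π) (fun z => ?_)
    by_cases hz : z = a
    · rw [hz, skip_self]
    · rw [skip_apply π hz]
      split_ifs with h
      · rw [← h]
        exact (sameCycle_step π z).trans (sameCycle_step π _)
      · exact sameCycle_step π z
  · intro h
    have := sameCycle_le (σ := π)
      (r := fun z z' => (skip π a).SameCycle (if z = a then π a else z) (if z' = a then π a else z'))
      ⟨fun _ => Perm.SameCycle.refl _ _, fun h => h.symm, fun h h' => h.trans h'⟩
      (fun z => by
        by_cases hz : z = a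
        · subst hz
          simpa using Perm.SameCycle.refl _ _
        · have := sameCycle_step (skip π a) z
          rw [skip_apply π hz] at this
          simpa [hz] using this) h
    simpa [hx, hy] using this

lemma sameCycle_swap [Finite X] {V : Type} {φ : X → V} {σ : Perm X}
    (hσ : ∀ x y, σ.SameCycle x y ↔ φ x = φ y) {a b : X} (hab : φ a ≠ φ b) (x y : X) :
    (σ * swap a b).SameCycle x y ↔
      (if φ x = φ b then φ a else φ x) = (if φ y = φ b then φ a else φ y) := by
  have hstep : ∀ z, φ (σ z) = φ z := fun z => ((hσ _ _).1 (sameCycle_step σ z)).symm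
  set π := σ * swap a b with hπ
  have ha : π a = σ b := by simp [hπ]
  have hb : π b = σ a := by simp [hπ]
  have hz : ∀ z, z ≠ a → z ≠ b → π z = σ z := fun z h1 h2 => by
    simp [hπ, Equiv.swap_apply_of_ne_of_ne h1 h2]
  constructor
  · refine sameCycle_le
      (r := fun u v => (if φ u = φ b then φ a else φ u) = (if φ v = φ b then φ a else φ v))
      ⟨fun _ => rfl, fun h => h.symm, fun h h' => h.trans h'⟩ (fun z => ?_)
    by_cases h1 : z = a
    · subst h1
      rw [ha, hstep]
      simp
    · by_cases h2 : z = b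
      · subst h2
        rw [hb, hstep]
        simp
      · rw [hz z h1 h2, hstep]
  · have key : ∀ c d, ((c = a ∧ d = b) ∨ (c = b ∧ d = a)) → π.SameCycle (σ c) c := by
      intro c d hcd
      have hcd' : φ c ≠ φ d := by rcases hcd with ⟨rfl, rfl⟩ | ⟨rfl, rfl⟩ <;> tauto
      have hzz : ∀ z, z ≠ c → z ≠ d → π z = σ z := by
        rcases hcd with ⟨rfl, rfl⟩ | ⟨rfl, rfl⟩
        · exact hz
        · exact fun z h1 h2 => hz z h2 h1
      have hk : ∀ k : ℕ, φ ((σ ^ k) (σ c)) = φ c ∧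
          (π.SameCycle (σ c) ((σ ^ k) (σ c)) ∨ π.SameCycle (σ c) c) := by
        intro k
        induction k with
        | zero => exact ⟨hstep c, Or.inl (Perm.SameCycle.refl _ _)⟩
        | succ n ih =>
          rw [pow_succ', Perm.mul_apply]
          refine ⟨(hstep _).trans ih.1, ?_⟩
          rcases ih.2 with h | h
          · by_cases hc : (σ ^ n) (σ c) = c
            · rw [hc] at h
              exact Or.inr h
            · have hd : (σ ^ n) (σ c) ≠ d := fun hd => hcd' (by rw [← ih.1, hd])
              rw [← hzz _ hc hd]
              exact Or.inl (h.trans (sameCycle_step π _))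
          · exact Or.inr h
      obtain ⟨i, -, hi⟩ := (sameCycle_step σ c).symm.exists_pow_eq'
      rcases (hk i).2 with h | h
      · rwa [hi] at h
      · exact h
    have hA : π.SameCycle (σ a) a := key a b (Or.inl ⟨rfl, rfl⟩)
    have hB : π.SameCycle (σ b) b := key b a (Or.inr ⟨rfl, rfl⟩)
    have hAB : π.SameCycle a b := by
      have := sameCycle_step π a
      rw [ha] at this
      exact this.trans hB
    have hall : ∀ z z', σ.SameCycle z z' → π.SameCycle z z' := fun z z' =>
      sameCycle_le (sameCycle_equivalence π) (fun z => by
        by_cases h1 : z = a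
        · subst h1
          exact hA.symm
        · by_cases h2 : z = b
          · subst h2
            exact hB.symm
          · rw [← hz z h1 h2]
            exact sameCycle_step π z)
    have hm : ∀ z, ∃ z', π.SameCycle z z' ∧ φ z' = if φ z = φ b then φ a else φ z := by
      intro z
      by_cases h : φ z = φ b
      · exact ⟨a, (hall z b ((hσ _ _).2 h)).trans hAB.symm, by simp [h]⟩
      · exact ⟨z, Perm.SameCycle.refl _ _, by simp [h]⟩
    intro h
    obtain ⟨x', hx, hx'⟩ := hm x
    obtain ⟨y', hy, hy'⟩ := hm y
    exact (hx.trans (hall x' y' ((hσ _ _).2 (by rw [hx', hy', h])))).trans hy.symm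

/-- Merging the cycles `(a₁, …, aᵢ = a)` and `(b₁, …, bⱼ = b)` of `σ` into the cycle
`(a₁, …, aᵢ₋₁, b₁, …, bⱼ₋₁)`: the product `σ * swap a b` has the cycle
`(a₁, …, aᵢ₋₁, a, b₁, …, bⱼ₋₁, b)`, from which `a` and `b` are dropped. -/
def mergeCycles (σ : Perm X) (a b : X) : Perm X := skip (skip (σ * swap a b) a) b

lemma mergeCycles_left (σ : Perm X) {a b : X} (hab : a ≠ b) : mergeCycles σ a b a = a := by
  rw [mergeCycles, skip_apply _ hab, skip_self, if_neg hab]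

lemma mergeCycles_right (σ : Perm X) (a b : X) : mergeCycles σ a b b = b := skip_self _ _

lemma skip_comm {Y : Type} {e : X → Y} (he : Function.Injective e) {σ : Perm X} {τ : Perm Y}
    (h : ∀ x, τ (e x) = e (σ x)) (a x : X) : skip τ (e a) (e x) = e (skip σ a x) := by
  simp only [skip, Perm.mul_apply, h, he.swap_apply]

lemma mergeCycles_comm {Y : Type} {e : X → Y} (he : Function.Injective e) {σ : Perm X}
    {τ : Perm Y} (h : ∀ x, τ (e x) = e (σ x)) (a b x : X) :
    mergeCycles τ (e a) (e b) (e x) = e (mergeCycles σ a b x) :=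
  skip_comm he (skip_comm he (fun x => by
    simp only [Perm.mul_apply, h, he.swap_apply]) a) b x

lemma skip_skip (π : Perm X) {a b : X} (hab : a ≠ b) :
    skip (skip π a) b = skip (skip π b) a := by
  ext x
  by_cases ha : x = a
  · subst ha
    rw [skip_apply _ hab, skip_self, if_neg hab, skip_self]
  · by_cases hb : x = b
    · subst hb
      rw [skip_self, skip_apply _ ha, skip_self, if_neg ha]
    · have h1 : π x ≠ π a := fun h => ha (π.injective h)
      have h2 : π x ≠ π b := fun h => hb (π.injective h)
      have h3 : π a ≠ π b := fun h => hab (π.injective h)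
      rw [skip_apply _ hb, skip_apply _ ha, skip_apply _ ha, skip_apply _ hb, skip_apply _ hab,
        skip_apply _ hab.symm]
      grind

lemma mergeCycles_symm (σ : Perm X) {a b : X} (hab : a ≠ b) :
    mergeCycles σ a b = mergeCycles σ b a := by
  rw [mergeCycles, mergeCycles, skip_skip _ hab, Equiv.swap_comm]

lemma skip_mul_swap (π : Perm X) {a c d : X} (hc : a ≠ c) (hd : a ≠ d) :
    skip (π * swap c d) a = skip π a * swap c d := by
  rw [skip, skip, Perm.mul_apply, Equiv.swap_apply_of_ne_of_ne hc hd, mul_assoc]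

lemma mergeCycles_mergeCycles (σ : Perm X) {a b c d : X} (hac : a ≠ c) (had : a ≠ d) (hbc : b ≠ c)
    (hbd : b ≠ d) : mergeCycles (mergeCycles σ a b) c d = mergeCycles (mergeCycles σ c d) a b := by
  have hs : swap a b * swap c d = swap c d * swap a b := by
    ext x
    simp only [Perm.mul_apply, Equiv.swap_apply_def]
    grind
  simp only [mergeCycles]
  rw [← skip_mul_swap _ hbc hbd, ← skip_mul_swap _ hac had, ← skip_mul_swap _ had.symm hbd.symm,
    ← skip_mul_swap _ hac.symm hbc.symm, mul_assoc, mul_assoc, hs]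
  rw [skip_skip _ hbc, skip_skip _ hbd, skip_skip _ hac, skip_skip _ had]

end Perm

namespace Graph

/-- A ribbon structure: a cyclic ordering on each fibre of `φV`, given by the permutation `next`
which sends each half-edge to the next one at the same vertex; its cycles are the fibres. -/
@[ext] structure CyclicOrdering (Γ : Graph) where
  next : Perm Γ.H
  sameCycle_iff : ∀ x y, next.SameCycle x y ↔ Γ.φV x = Γ.φV y

lemma mergeCycles_mem (Γ : Graph) (σ : Perm Γ.H) (h x : Γ.H) :
    Γ.φE (mergeCycles σ h (Γ.flip h) x) ≠ Γ.φE h ↔ Γ.φE x ≠ Γ.φE h := by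
  have hl := mergeCycles_left σ (Γ.flip_ne h).symm
  have hr := mergeCycles_right σ h (Γ.flip h)
  refine not_congr ⟨fun hx => ?_, fun hx => ?_⟩
  · rcases Γ.eq_or_eq_flip hx with h1 | h1
    · rw [(mergeCycles σ h (Γ.flip h)).injective (h1.trans hl.symm)]
    · rw [(mergeCycles σ h (Γ.flip h)).injective (h1.trans hr.symm), φE_flip]
  · rcases Γ.eq_or_eq_flip hx with rfl | rfl
    · rw [hl]
    · rw [hr, φE_flip]

/-- The ribbon structure induced on the contraction. -/
def CyclicOrdering.contract {Γ : Graph} (c : Γ.CyclicOrdering) (h : Γ.H)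
    (hc : Γ.Contractible h) : (Γ.contract h hc).CyclicOrdering where
  next := (mergeCycles c.next h (Γ.flip h)).subtypePerm (Γ.mergeCycles_mem c.next h)
  sameCycle_iff x y := by
    have hx : x.1 ≠ h := fun hh => x.2 (by rw [hh])
    have hy : y.1 ≠ h := fun hh => y.2 (by rw [hh])
    have hx' : x.1 ≠ Γ.flip h := fun hh => x.2 (by rw [hh, φE_flip])
    have hy' : y.1 ≠ Γ.flip h := fun hh => y.2 (by rw [hh, φE_flip])
    refine Perm.sameCycle_subtypePerm.trans ?_
    rw [mergeCycles, sameCycle_skip _ hx' hy', sameCycle_skip _ hx hy,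
      sameCycle_swap c.sameCycle_iff hc.1, ← Γ.merge_val h hc.1, ← Γ.merge_val h hc.1,
      ← Subtype.ext_iff]
    rfl

end Graph

/-- The two types of graph complexes. -/
inductive Kind
  | commutative
  | ribbon

/-- Oriented graphs (for `k = commutative`) and oriented ribbon graphs (for `k = ribbon`): the
cyclic orderings at the vertices are part of the data only in the second case. -/
structure OGraph (k : Kind) extends Graph where
  cyc : k = Kind.ribbon → toGraph.CyclicOrdering
  orient : toGraph.Orientation

namespace OGraph

variable {k : Kind}

/-- The same graph with the opposite orientation. -/
def opp (Γ : OGraph k) : OGraph k where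
  toGraph := Γ.toGraph
  cyc := Γ.cyc
  orient := Γ.orient.opp

/-- The contraction of an edge in an oriented (ribbon) graph. -/
def contract (Γ : OGraph k) (h : Γ.H) (hc : Γ.Contractible h) : OGraph k where
  toGraph := Γ.toGraph.contract h hc
  cyc hr := (Γ.cyc hr).contract h hc
  orient := Γ.orient.contract h hc

/-- An isomorphism of oriented graphs, or of oriented ribbon graphs. -/
structure Iso (Γ Δ : OGraph k) where
  onH : Γ.H ≃ Δ.H
  onV : Γ.V ≃ Δ.V
  onE : Γ.E ≃ Δ.E
  φV_comm : ∀ x, Δ.φV (onH x) = onV (Γ.φV x)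
  φE_comm : ∀ x, Δ.φE (onH x) = onE (Γ.φE x)
  cyc_comm : ∀ hr x, (Δ.cyc hr).next (onH x) = onH ((Γ.cyc hr).next x)
  sign_comm : ∀ l w, Δ.orient.sign (l.map onH) (w.map onV) = Γ.orient.sign l w

namespace Iso

variable {Γ Δ : OGraph k}

lemma flip_comm (i : Iso Γ Δ) (h : Γ.H) : Δ.flip (i.onH h) = i.onH (Γ.flip h) := by
  symm
  apply Δ.flip_unique
  · rw [i.φE_comm, i.φE_comm, Γ.φE_flip]
  · exact fun hh => Γ.flip_ne h (i.onH.injective hh)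

lemma contractible_iff (i : Iso Γ Δ) (h : Γ.H) :
    Δ.Contractible (i.onH h) ↔ Γ.Contractible h := by
  unfold Graph.Contractible
  rw [← i.onH.exists_congr_right]
  simp only [i.flip_comm, i.φV_comm, i.φE_comm, ne_eq, EmbeddingLike.apply_eq_iff_eq]

/-- An isomorphism induces an isomorphism of contractions. -/
def contract (i : Iso Γ Δ) (h : Γ.H) (hc : Γ.Contractible h) (hc' : Δ.Contractible (i.onH h)) :
    Iso (Γ.contract h hc) (Δ.contract (i.onH h) hc') where
  onH := i.onH.subtypeEquiv (fun x => by simp [i.φE_comm])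
  onV := i.onV.subtypeEquiv (fun v => by simp [i.flip_comm, i.φV_comm])
  onE := i.onE.subtypeEquiv (fun e => by simp [i.φE_comm])
  φV_comm x := by
    apply Subtype.ext
    change (Δ.merge (i.onH h) hc'.1 (Δ.φV (i.onH x.1))).1 = i.onV (Γ.merge h hc.1 (Γ.φV x.1)).1
    simp only [Graph.merge_val, i.φV_comm, i.flip_comm, EmbeddingLike.apply_eq_iff_eq,
      apply_ite i.onV]
  φE_comm x := Subtype.ext (i.φE_comm x.1)
  cyc_comm hr x := by
    apply Subtype.ext
    change mergeCycles (Δ.cyc hr).next (i.onH h) (Δ.flip (i.onH h)) (i.onH x.1) =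
      i.onH (mergeCycles (Γ.cyc hr).next h (Γ.flip h) x.1)
    rw [i.flip_comm]
    exact mergeCycles_comm i.onH.injective (i.cyc_comm hr) _ _ _
  sign_comm l w := by
    refine congrArg Neg.neg (Eq.trans ?_ (i.sign_comm _ _))
    refine congrArg₂ Δ.orient.sign ?_ ?_
    · exact Graph.extendH_map i.onH _ rfl (i.flip_comm h).symm (fun _ => rfl) l
    · exact TotalOrdering.cons_map i.onV _ (by rw [i.flip_comm, i.φV_comm]) (fun _ => rfl) w

/-- The two halves of an edge give isomorphic contractions. -/
def ofFlip (Γ : OGraph k) (h : Γ.H) (hc : Γ.Contractible h) (hc' : Γ.Contractible (Γ.flip h)) :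
    Iso (Γ.contract h hc) (Γ.contract (Γ.flip h) hc') where
  onH := Equiv.subtypeEquivRight (fun x => by rw [Γ.φE_flip])
  onV := (swap (Γ.φV h) (Γ.φV (Γ.flip h))).subtypeEquiv (fun v => by
    rw [Γ.flip_flip, Equiv.swap_apply_def]
    have := hc.1
    grind)
  onE := Equiv.subtypeEquivRight (fun x => by rw [Γ.φE_flip])
  φV_comm x := by
    apply Subtype.ext
    change (Γ.merge (Γ.flip h) hc'.1 (Γ.φV x.1)).1 =
      swap (Γ.φV h) (Γ.φV (Γ.flip h)) (Γ.merge h hc.1 (Γ.φV x.1)).1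
    simp only [Graph.merge_val, Γ.flip_flip, Equiv.swap_apply_def]
    grind
  φE_comm x := rfl
  cyc_comm hr x := by
    apply Subtype.ext
    change mergeCycles (Γ.cyc hr).next (Γ.flip h) (Γ.flip (Γ.flip h)) x.1 =
      mergeCycles (Γ.cyc hr).next h (Γ.flip h) x.1
    rw [Γ.flip_flip, mergeCycles_symm _ (Γ.flip_ne h)]
  sign_comm l w := by
    refine congrArg Neg.neg (Eq.trans (congrArg₂ Γ.orient.sign
      (Graph.extendH_map (swap h (Γ.flip h)) _ ?_ ?_ ?_ l)
      (TotalOrdering.cons_map (swap (Γ.φV h) (Γ.φV (Γ.flip h))) _ ?_ (fun _ => rfl) w)) ?_)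
    · simp
    · simp [Γ.flip_flip]
    · intro x
      have := x.2
      have h2 := Γ.φE_flip h
      exact (Equiv.swap_apply_of_ne_of_ne (by grind) (by grind)).symm
    · simp [Γ.flip_flip]
    · rw [Γ.orient.swap_H _ _ (Γ.flip_ne h).symm, Γ.orient.swap_V _ _ hc.1, neg_neg]

/-- Isomorphic graphs have isomorphic opposites. -/
def opp (i : Iso Γ Δ) : Iso Γ.opp Δ.opp where
  onH := i.onH
  onV := i.onV
  onE := i.onE
  φV_comm := i.φV_comm
  φE_comm := i.φE_comm
  cyc_comm := i.cyc_comm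
  sign_comm l w := congrArg Neg.neg (i.sign_comm l w)

/-- Exchanging two conditions in an iterated subtype. -/
def exchange {X : Type} {P Q : X → Prop} {Q' : {x // P x} → Prop} {P' : {x // Q x} → Prop}
    (hQ : ∀ x, Q' x ↔ Q x.1) (hP : ∀ x, P' x ↔ P x.1) : {x // Q' x} ≃ {x // P' x} where
  toFun x := ⟨⟨x.1.1, (hQ _).1 x.2⟩, (hP _).2 x.1.2⟩
  invFun x := ⟨⟨x.1.1, (hP _).1 x.2⟩, (hQ _).2 x.1.2⟩
  left_inv _ := rfl
  right_inv _ := rfl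

end Iso

lemma contract_flip (Γ : OGraph k) (h : Γ.H) (hc : Γ.Contractible h) (x : Γ.RestH h) :
    ((Γ.contract h hc).flip x).1 = Γ.flip x.1 :=
  Γ.toGraph.contract_flip h hc x

lemma map_map_map {A B C D E : Type} (l : List A) (f : A → B) (g : B → C) (h : C → D) (p : A → E)
    (q : E → D) (H : ∀ x, h (g (f x)) = q (p x)) :
    ((l.map f).map g).map h = (l.map p).map q := by
  simp [H]

/-- Contracting two edges in the two possible orders yields opposite orientations. -/
def Iso.ofComm (Γ : OGraph k) (a b : Γ.H) (hab : Γ.φE b ≠ Γ.φE a) (ha : Γ.Contractible a)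
    (hb : Γ.Contractible b) (hb' : (Γ.contract a ha).Contractible ⟨b, hab⟩)
    (ha' : (Γ.contract b hb).Contractible ⟨a, hab.symm⟩)
    (g1 : Γ.φV (Γ.flip a) ≠ Γ.φV b) (g2 : Γ.φV (Γ.flip b) ≠ Γ.φV a)
    (g3 : Γ.φV (Γ.flip a) ≠ Γ.φV (Γ.flip b)) :
    Iso ((Γ.contract a ha).contract ⟨b, hab⟩ hb')
      ((Γ.contract b hb).contract ⟨a, hab.symm⟩ ha').opp :=
  have hv : (((Γ.contract a ha).φV ((Γ.contract a ha).flip ⟨b, hab⟩)) : Γ.MergedV a).1 =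
      Γ.φV (Γ.flip b) := by
    refine (Γ.merge_val _ _ _).trans ?_
    rw [contract_flip, if_neg g3.symm]
  have hw : (((Γ.contract b hb).φV ((Γ.contract b hb).flip ⟨a, hab.symm⟩)) : Γ.MergedV b).1 =
      Γ.φV (Γ.flip a) := by
    refine (Γ.merge_val _ _ _).trans ?_
    rw [contract_flip, if_neg g3]
  have hQH : ∀ x : Γ.RestH a, (Γ.contract a ha).φE x ≠ (Γ.contract a ha).φE ⟨b, hab⟩ ↔
      Γ.φE x.1 ≠ Γ.φE b := fun x => not_congr Subtype.ext_iff
  have hPH : ∀ x : Γ.RestH b, (Γ.contract b hb).φE x ≠ (Γ.contract b hb).φE ⟨a, hab.symm⟩ ↔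
      Γ.φE x.1 ≠ Γ.φE a := fun x => not_congr Subtype.ext_iff
  have hQV : ∀ x : Γ.MergedV a, x ≠ (Γ.contract a ha).φV ((Γ.contract a ha).flip ⟨b, hab⟩) ↔
      x.1 ≠ Γ.φV (Γ.flip b) := fun x => not_congr (Subtype.ext_iff.trans (Eq.congr_right hv))
  have hPV : ∀ x : Γ.MergedV b, x ≠ (Γ.contract b hb).φV ((Γ.contract b hb).flip ⟨a, hab.symm⟩) ↔
      x.1 ≠ Γ.φV (Γ.flip a) := fun x => not_congr (Subtype.ext_iff.trans (Eq.congr_right hw))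
  { onH := exchange hQH hPH
    onV := exchange hQV hPV
    onE := exchange (P := fun x => x ≠ Γ.φE a) (Q := fun x => x ≠ Γ.φE b)
      (fun x => not_congr Subtype.ext_iff) (fun x => not_congr Subtype.ext_iff)
    φV_comm := fun x => by
      apply Subtype.ext
      apply Subtype.ext
      refine ((Γ.contract b hb).merge_apply _ ha'.1 (f := (Subtype.val : Γ.MergedV b → Γ.V))
        Subtype.val_injective _).trans ?_
      refine Eq.trans ?_ ((Γ.contract a ha).merge_apply _ hb'.1
        (f := (Subtype.val : Γ.MergedV a → Γ.V)) Subtype.val_injective _).symm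
      refine (congrArg (fun z => if _ = z then _ else _) hw).trans ?_
      refine Eq.trans ?_ (congrArg (fun z => if _ = z then _ else _) hv).symm
      change (if (Γ.merge b hb.1 (Γ.φV x.1.1)).1 = _ then (Γ.merge b hb.1 (Γ.φV a)).1 else
        (Γ.merge b hb.1 (Γ.φV x.1.1)).1) = (if (Γ.merge a ha.1 (Γ.φV x.1.1)).1 = _ then
        (Γ.merge a ha.1 (Γ.φV b)).1 else (Γ.merge a ha.1 (Γ.φV x.1.1)).1)
      simp only [Graph.merge_val]
      grind
    φE_comm := fun x => rfl
    cyc_comm := fun hr x => by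
      apply Subtype.ext
      apply Subtype.ext
      have h1 : a ≠ b := fun h => hab (by rw [h])
      have h2 : a ≠ Γ.flip b := fun h => hab (by rw [h, Γ.φE_flip])
      have h3 : Γ.flip a ≠ b := fun h => hab (by rw [← h, Γ.φE_flip])
      have h4 : Γ.flip a ≠ Γ.flip b := fun h => hab (by rw [← Γ.φE_flip b, ← h, Γ.φE_flip])
      have e1 := mergeCycles_comm (e := (Subtype.val : Γ.RestH b → Γ.H)) Subtype.val_injective
        (σ := ((Γ.contract b hb).cyc hr).next)
        (τ := mergeCycles (Γ.cyc hr).next b (Γ.flip b)) (fun _ => rfl) ⟨a, hab.symm⟩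
        ((Γ.contract b hb).flip ⟨a, hab.symm⟩) ⟨x.1.1, fun h => x.2 (Subtype.ext h)⟩
      have e2 := mergeCycles_comm (e := (Subtype.val : Γ.RestH a → Γ.H)) Subtype.val_injective
        (σ := ((Γ.contract a ha).cyc hr).next)
        (τ := mergeCycles (Γ.cyc hr).next a (Γ.flip a)) (fun _ => rfl) ⟨b, hab⟩
        ((Γ.contract a ha).flip ⟨b, hab⟩) x.1
      rw [contract_flip] at e1 e2
      refine e1.symm.trans (Eq.trans ?_ e2)
      rw [mergeCycles_mergeCycles _ h1.symm h3.symm h2.symm h4.symm]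
    sign_comm := fun l w => by
      have h1 : a ≠ b := fun h => hab (by rw [h])
      have h2 : a ≠ Γ.flip b := fun h => hab (by rw [h, Γ.φE_flip])
      have h3 : Γ.flip a ≠ b := fun h => hab (by rw [← h, Γ.φE_flip])
      have h4 : Γ.flip a ≠ Γ.flip b := fun h => hab (by rw [← Γ.φE_flip b, ← h, Γ.φE_flip])
      have h5 := Γ.flip_ne a
      have h6 := Γ.flip_ne b
      have f1 := contract_flip Γ a ha ⟨b, hab⟩
      have f2 := contract_flip Γ b hb ⟨a, hab.symm⟩
      have hA : Γ.extendH b ((Γ.contract b hb).extendH ⟨a, hab.symm⟩ (l.map (exchange hQH hPH))) =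
          ((Γ.extendH a ((Γ.contract a ha).extendH ⟨b, hab⟩ l)).map (swap a b)).map
            (swap (Γ.flip a) (Γ.flip b)) := by
        apply TotalOrdering.ext
        change b :: Γ.flip b :: List.map Subtype.val (_ :: _ ::
            List.map Subtype.val (List.map _ l.toList)) =
          List.map _ (List.map _ (a :: Γ.flip a :: List.map Subtype.val (_ :: _ ::
            List.map Subtype.val l.toList)))
        simp only [List.map_cons, List.map_map]
        refine congrArg₂ List.cons ?_ (congrArg₂ List.cons ?_ (congrArg₂ List.cons ?_
          (congrArg₂ List.cons ?_ ?_)))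
        · rw [Equiv.swap_apply_left, Equiv.swap_apply_of_ne_of_ne h3.symm h6.symm]
        · rw [Equiv.swap_apply_of_ne_of_ne h5 h3, Equiv.swap_apply_left]
        · rw [Equiv.swap_apply_right, Equiv.swap_apply_of_ne_of_ne h5.symm h2]
        · refine f2.trans (Eq.trans ?_ (congrArg (fun z => swap (Γ.flip a) (Γ.flip b)
            (swap a b z)) f1).symm)
          change Γ.flip a = swap (Γ.flip a) (Γ.flip b) (swap a b (Γ.flip b))
          rw [Equiv.swap_apply_of_ne_of_ne h2.symm h6, Equiv.swap_apply_right]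
        · refine map_map_map _ _ _ _ _ _ (fun x => ?_)
          have q1 := x.1.2
          have q2 : Γ.φE x.1.1 ≠ Γ.φE b := fun h => x.2 (Subtype.ext h)
          have q3 := Γ.φE_flip a
          have q4 := Γ.φE_flip b
          simp only [Function.comp]
          rw [Equiv.swap_apply_of_ne_of_ne (a := a) (by grind) (by grind),
            Equiv.swap_apply_of_ne_of_ne (by grind) (by grind)]
          rfl
      have hB : TotalOrdering.cons (Γ.φV (Γ.flip b)) (TotalOrdering.cons
            ((Γ.contract b hb).φV ((Γ.contract b hb).flip ⟨a, hab.symm⟩))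
            (w.map (exchange hQV hPV))) =
          (TotalOrdering.cons (Γ.φV (Γ.flip a)) (TotalOrdering.cons
            ((Γ.contract a ha).φV ((Γ.contract a ha).flip ⟨b, hab⟩)) w)).map
            (swap (Γ.φV (Γ.flip a)) (Γ.φV (Γ.flip b))) := by
        apply TotalOrdering.ext
        change Γ.φV (Γ.flip b) :: List.map Subtype.val (_ ::
            List.map Subtype.val (List.map _ w.toList)) =
          List.map _ (Γ.φV (Γ.flip a) :: List.map Subtype.val (_ ::
            List.map Subtype.val w.toList))
        simp only [List.map_cons, List.map_map]
        refine congrArg₂ List.cons ?_ (congrArg₂ List.cons ?_ ?_)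
        · rw [Equiv.swap_apply_left]
        · refine hw.trans (Eq.trans ?_ (congrArg _ hv).symm)
          rw [Equiv.swap_apply_right]
        · refine map_map_map _ _ _ _ _ _ (fun x => ?_)
          have q1 := x.1.2
          have q2 : x.1.1 ≠ Γ.φV (Γ.flip b) := fun h => x.2 (Subtype.ext (h.trans hv.symm))
          simp only [Function.comp]
          rw [Equiv.swap_apply_of_ne_of_ne q1 q2]
          rfl
      refine (congrArg (fun z => - - -z) (congrArg₂ Γ.orient.sign hA hB)).trans ?_
      simp only [Γ.orient.swap_V _ _ g3, Γ.orient.swap_H _ _ h4, Γ.orient.swap_H _ _ h1, neg_neg]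
      exact (neg_neg _).symm }

lemma card_contract (Γ : OGraph k) (h : Γ.H) (hc : Γ.Contractible h) {m : ℕ}
    (hm : Nat.card Γ.E = m + 1) : Nat.card (Γ.contract h hc).E = m := by
  have h1 : Nat.card (Γ.contract h hc).E = Nat.card {e : Γ.E // e ≠ Γ.φE h} := rfl
  rw [h1, Nat.card_eq_fintype_card, Fintype.card_subtype_compl, Fintype.card_subtype_eq, ← Nat.card_eq_fintype_card, hm]
  rfl

end OGraph

/-! ### The complexes -/

variable (K : Type*) [Field K] (k : Kind)

/-- Oriented (ribbon) graphs with `m` edges. -/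
abbrev GraphOf (m : ℕ) : Type 1 := {Γ : OGraph k // Nat.card Γ.E = m}

/-- The relations between oriented graphs: isomorphic oriented graphs are equal, and a graph is the
negative of the same graph with the opposite orientation. -/
def relations (m : ℕ) : Submodule K (GraphOf k m →₀ K) :=
  Submodule.span K
    ({z | ∃ Γ Δ : GraphOf k m, Nonempty (OGraph.Iso Γ.1 Δ.1) ∧
        z = Finsupp.single Γ 1 - Finsupp.single Δ 1} ∪
      {z | ∃ Γ : GraphOf k m,
        z = Finsupp.single Γ 1 + Finsupp.single (⟨Γ.1.opp, Γ.2⟩ : GraphOf k m) 1})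

/-- The space spanned by the isomorphism classes of oriented graphs with `m` edges, modulo the
relation that a graph is the negative of the graph with the opposite orientation. -/
abbrev Chain (m : ℕ) : Type _ := (GraphOf k m →₀ K) ⧸ relations K k m

variable {k}

/-- The class of an oriented graph. -/
def cls {m : ℕ} (Γ : OGraph k) (hm : Nat.card Γ.E = m) : Chain K k m :=
  (relations K k m).mkQ (Finsupp.single ⟨Γ, hm⟩ 1)

lemma cls_iso {m : ℕ} {Γ Δ : OGraph k} (i : OGraph.Iso Γ Δ) (hm : Nat.card Γ.E = m)
    (hm' : Nat.card Δ.E = m) : cls K Γ hm = cls K Δ hm' := by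
  rw [← sub_eq_zero, cls, cls, ← map_sub, Submodule.mkQ_apply, Submodule.Quotient.mk_eq_zero]
  exact Submodule.subset_span (Or.inl ⟨⟨Γ, hm⟩, ⟨Δ, hm'⟩, ⟨i⟩, rfl⟩)

lemma cls_opp {m : ℕ} (Γ : OGraph k) (hm : Nat.card Γ.E = m) (hm' : Nat.card Γ.opp.E = m) :
    cls K Γ.opp hm' = -cls K Γ hm := by
  rw [eq_neg_iff_add_eq_zero, add_comm]
  unfold cls
  rw [← map_add, Submodule.mkQ_apply,
    Submodule.Quotient.mk_eq_zero]
  exact Submodule.subset_span (Or.inr ⟨⟨Γ, hm⟩, rfl⟩)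

/-- The class of the contraction of the edge of `h`; it is zero if this edge is a loop, or if the
contraction would produce a vertex of valence zero. -/
def contractCls {m : ℕ} (Γ : OGraph k) (hm : Nat.card Γ.E = m + 1) (h : Γ.H) : Chain K k m :=
  if hc : Γ.Contractible h then cls K (Γ.contract h hc) (Γ.card_contract h hc hm) else 0

lemma contractCls_pos {m : ℕ} (Γ : OGraph k) (hm : Nat.card Γ.E = m + 1) {h : Γ.H}
    (hc : Γ.Contractible h) :
    contractCls K Γ hm h = cls K (Γ.contract h hc) (Γ.card_contract h hc hm) := dif_pos hc

lemma contractCls_neg {m : ℕ} (Γ : OGraph k) (hm : Nat.card Γ.E = m + 1) {h : Γ.H}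
    (hc : ¬ Γ.Contractible h) : contractCls K Γ hm h = 0 := dif_neg hc

lemma contractCls_iso {m : ℕ} {Γ Δ : OGraph k} (i : OGraph.Iso Γ Δ) (hm : Nat.card Γ.E = m + 1)
    (hm' : Nat.card Δ.E = m + 1) (h : Γ.H) :
    contractCls K Γ hm h = contractCls K Δ hm' (i.onH h) := by
  by_cases hc : Γ.Contractible h
  · have hc' := (i.contractible_iff h).2 hc
    rw [contractCls, contractCls, dif_pos hc, dif_pos hc']
    exact cls_iso K (i.contract h hc hc') _ _
  · have hc' := fun h' => hc ((i.contractible_iff h).1 h')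
    rw [contractCls, contractCls, dif_neg hc, dif_neg hc']

lemma contractible_flip (Γ : Graph) (h : Γ.H) : Γ.Contractible (Γ.flip h) ↔ Γ.Contractible h := by
  unfold Graph.Contractible
  rw [Γ.flip_flip, Γ.φE_flip]
  refine and_congr ne_comm (exists_congr fun x => and_congr_right fun _ => or_comm)

lemma contractCls_edge {m : ℕ} (Γ : OGraph k) (hm : Nat.card Γ.E = m + 1) {h h' : Γ.H}
    (hh : Γ.φE h' = Γ.φE h) : contractCls K Γ hm h' = contractCls K Γ hm h := by
  rcases Γ.eq_or_eq_flip hh with rfl | rfl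
  · rfl
  · by_cases hc : Γ.Contractible h
    · have hc' := (contractible_flip Γ.toGraph h).2 hc
      rw [contractCls, contractCls, dif_pos hc, dif_pos hc']
      exact (cls_iso K (OGraph.Iso.ofFlip Γ h hc hc') _ _).symm
    · have hc' := fun h' => hc ((contractible_flip Γ.toGraph h).1 h')
      rw [contractCls, contractCls, dif_neg hc, dif_neg hc']

/-- One of the two halves of an edge. -/
def Graph.half (Γ : Graph) (e : Γ.E) : Γ.H := Function.surjInv Γ.φE_surj e

lemma Graph.φE_half (Γ : Graph) (e : Γ.E) : Γ.φE (Γ.half e) = e := Function.surjInv_eq _ _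

/-- The sum of the contractions of all the edges of an oriented graph. -/
def boundary {m : ℕ} (Γ : OGraph k) (hm : Nat.card Γ.E = m + 1) : Chain K k m :=
  ∑ e : Γ.E, contractCls K Γ hm (Γ.half e)

lemma boundary_iso {m : ℕ} {Γ Δ : OGraph k} (i : OGraph.Iso Γ Δ) (hm : Nat.card Γ.E = m + 1)
    (hm' : Nat.card Δ.E = m + 1) : boundary K Γ hm = boundary K Δ hm' := by
  refine Fintype.sum_equiv i.onE _ _ (fun e => ?_)
  rw [contractCls_iso K i hm hm']
  apply contractCls_edge
  rw [i.φE_comm, Γ.φE_half, Δ.φE_half]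

lemma boundary_opp {m : ℕ} (Γ : OGraph k) (hm : Nat.card Γ.E = m + 1)
    (hm' : Nat.card Γ.opp.E = m + 1) : boundary K Γ.opp hm' = -boundary K Γ hm := by
  unfold boundary
  rw [← Finset.sum_neg_distrib]
  refine Finset.sum_congr rfl (fun e _ => ?_)
  change contractCls K Γ.opp hm' (Γ.half e) = _
  by_cases hc : Γ.Contractible (Γ.half e)
  · have hc' : Γ.opp.Contractible (Γ.half e) := hc
    rw [contractCls_pos K _ _ hc, contractCls_pos K _ _ hc']
    exact cls_opp K (Γ.contract (Γ.half e) hc) _ _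
  · have hc' : ¬ Γ.opp.Contractible (Γ.half e) := hc
    rw [contractCls_neg K _ _ hc, contractCls_neg K _ _ hc', neg_zero]

variable (k)

/-- The differential on oriented graphs with a fixed number of edges:
`d Γ` is the sum over all edges `e` of the contractions `d_e Γ`. -/
def dChain (m : ℕ) : Chain K k (m + 1) →ₗ[K] Chain K k m :=
  (relations K k (m + 1)).liftQ (Finsupp.linearCombination K fun Γ => boundary K Γ.1 Γ.2) <| by
    rw [relations, Submodule.span_le]
    rintro z (⟨Γ, Δ, ⟨i⟩, rfl⟩ | ⟨Γ, rfl⟩)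
    · simp only [SetLike.mem_coe, LinearMap.mem_ker, map_sub, Finsupp.linearCombination_single,
        one_smul]
      rw [boundary_iso K i Γ.2 Δ.2, sub_self]
    · simp only [SetLike.mem_coe, LinearMap.mem_ker, map_add, Finsupp.linearCombination_single,
        one_smul]
      rw [boundary_opp K Γ.1 Γ.2, add_neg_cancel]

variable {k} in
lemma dChain_cls {m : ℕ} (Γ : OGraph k) (hm : Nat.card Γ.E = m + 1) :
    dChain K k m (cls K Γ hm) = boundary K Γ hm := by
  simp [dChain, cls]

variable {k} in
lemma chain_induction {m : ℕ} {p : Chain K k m → Prop} (x : Chain K k m)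
    (h0 : p 0) (hadd : ∀ x y, p x → p y → p (x + y)) (hsmul : ∀ (c : K) x, p x → p (c • x))
    (hcls : ∀ (Γ : OGraph k) (hm : Nat.card Γ.E = m), p (cls K Γ hm)) : p x := by
  obtain ⟨z, rfl⟩ := (relations K k m).mkQ_surjective x
  induction z using Finsupp.induction_linear with
  | zero => simpa using h0
  | add f g hf hg => rw [map_add]; exact hadd _ _ hf hg
  | single Γ c =>
    have : Finsupp.single Γ c = c • Finsupp.single Γ (1 : K) := by simp
    rw [this, map_smul]
    exact hsmul _ _ (hcls Γ.1 Γ.2)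

variable {k} in
/-- Contract the edge of `a`, and then the edge of `b`. -/
def contractCls₂ {m : ℕ} (Γ : OGraph k) (hm : Nat.card Γ.E = m + 2) (a b : Γ.H)
    (hab : Γ.φE b ≠ Γ.φE a) : Chain K k m :=
  if hc : Γ.Contractible a then
    contractCls K (Γ.contract a hc) (Γ.card_contract a hc hm) ⟨b, hab⟩ else 0

variable {k} in
lemma contractCls₂_edge {m : ℕ} (Γ : OGraph k) (hm : Nat.card Γ.E = m + 2) {a b a' b' : Γ.H}
    (hab : Γ.φE b ≠ Γ.φE a) (hab' : Γ.φE b' ≠ Γ.φE a') (ha : Γ.φE a' = Γ.φE a)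
    (hb : Γ.φE b' = Γ.φE b) : contractCls₂ K Γ hm a' b' hab' = contractCls₂ K Γ hm a b hab := by
  have h1 : contractCls₂ K Γ hm a b' (by rwa [hb]) = contractCls₂ K Γ hm a b hab := by
    unfold contractCls₂
    split_ifs with hc
    · exact contractCls_edge K _ _ (Subtype.ext hb)
    · rfl
  rw [← h1]
  rcases Γ.eq_or_eq_flip ha with rfl | rfl
  · rfl
  · by_cases hc : Γ.Contractible a
    · have hc' := (contractible_flip Γ.toGraph a).2 hc
      rw [contractCls₂, contractCls₂, dif_pos hc, dif_pos hc']
      exact (contractCls_iso K (OGraph.Iso.ofFlip Γ a hc hc') _ _ ⟨b', by rwa [hb]⟩).symm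
    · have hc' := fun h' => hc ((contractible_flip Γ.toGraph a).1 h')
      rw [contractCls₂, contractCls₂, dif_neg hc, dif_neg hc']

variable {k}

lemma contractible_contract (Γ : Graph) {a b : Γ.H} (hab : Γ.φE b ≠ Γ.φE a)
    (ha : Γ.Contractible a) : (Γ.contract a ha).Contractible ⟨b, hab⟩ ↔
      (Γ.merge a ha.1 (Γ.φV b)).1 ≠ (Γ.merge a ha.1 (Γ.φV (Γ.flip b))).1 ∧
      ∃ x, Γ.φE x ≠ Γ.φE a ∧ Γ.φE x ≠ Γ.φE b ∧
        ((Γ.merge a ha.1 (Γ.φV x)).1 = (Γ.merge a ha.1 (Γ.φV b)).1 ∨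
          (Γ.merge a ha.1 (Γ.φV x)).1 = (Γ.merge a ha.1 (Γ.φV (Γ.flip b))).1) := by
  have hf : (Γ.contract a ha).φV ((Γ.contract a ha).flip ⟨b, hab⟩) =
      Γ.merge a ha.1 (Γ.φV (Γ.flip b)) :=
    congrArg (fun z => Γ.merge a ha.1 (Γ.φV z)) (Γ.contract_flip a ha ⟨b, hab⟩)
  unfold Graph.Contractible
  rw [hf]
  refine and_congr (not_congr Subtype.ext_iff) ⟨?_, ?_⟩
  · rintro ⟨x, h1, h2⟩
    exact ⟨x.1, x.2, fun h => h1 (Subtype.ext h), h2.imp Subtype.ext_iff.1 Subtype.ext_iff.1⟩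
  · rintro ⟨x, h1, h2, h3⟩
    exact ⟨⟨x, h1⟩, fun h => h2 (Subtype.ext_iff.1 h), h3.imp Subtype.ext Subtype.ext⟩

lemma contractible_exchange (Γ : Graph) {a b : Γ.H} (hab : Γ.φE b ≠ Γ.φE a)
    (g1 : Γ.φV (Γ.flip a) ≠ Γ.φV b) (g2 : Γ.φV (Γ.flip b) ≠ Γ.φV a)
    (g3 : Γ.φV (Γ.flip a) ≠ Γ.φV (Γ.flip b)) (ha : Γ.Contractible a)
    (h : (Γ.contract a ha).Contractible ⟨b, hab⟩) :
    ∃ hb : Γ.Contractible b, (Γ.contract b hb).Contractible ⟨a, hab.symm⟩ := by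
  have ha1 := ha.1
  have ha2 := ha.2
  have hfa := Γ.φE_flip a
  rw [contractible_contract] at h
  simp only [Graph.merge_val] at h
  have hb1 : Γ.φV b ≠ Γ.φV (Γ.flip b) := by grind
  have hb : Γ.Contractible b := by
    refine ⟨hb1, ?_⟩
    by_cases hs : Γ.φV a = Γ.φV b
    · exact ⟨a, hab.symm, Or.inl hs⟩
    · obtain ⟨-, x, -, hx, hx'⟩ := h
      exact ⟨x, hx, by grind⟩
  refine ⟨hb, (contractible_contract Γ _ hb).2 ?_⟩
  simp only [Graph.merge_val]
  refine ⟨by grind, ?_⟩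
  by_cases hs : Γ.φV a = Γ.φV b
  · obtain ⟨-, x, hx, hx', hx''⟩ := h
    exact ⟨x, hx', hx, by grind⟩
  · obtain ⟨x, hx, hx'⟩ := ha2
    refine ⟨x, fun hh => ?_, hx, by grind⟩
    rcases Γ.eq_or_eq_flip hh with rfl | rfl <;> grind

lemma contractCls₂_generic {m : ℕ} (Γ : OGraph k) (hm : Nat.card Γ.E = m + 2) {a b : Γ.H}
    (hab : Γ.φE b ≠ Γ.φE a) (g1 : Γ.φV (Γ.flip a) ≠ Γ.φV b) (g2 : Γ.φV (Γ.flip b) ≠ Γ.φV a)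
    (g3 : Γ.φV (Γ.flip a) ≠ Γ.φV (Γ.flip b)) :
    contractCls₂ K Γ hm a b hab = -contractCls₂ K Γ hm b a hab.symm := by
  by_cases h : ∃ ha : Γ.Contractible a, (Γ.contract a ha).Contractible ⟨b, hab⟩
  · obtain ⟨ha, hb'⟩ := h
    obtain ⟨hb, ha'⟩ := contractible_exchange Γ.toGraph hab g1 g2 g3 ha hb'
    rw [contractCls₂, contractCls₂, dif_pos ha, dif_pos hb]
    refine (contractCls_pos K _ _ hb').trans
      (Eq.trans ?_ (congrArg Neg.neg (contractCls_pos K _ _ ha')).symm)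
    refine Eq.trans ?_ (cls_opp K ((Γ.contract b hb).contract ⟨a, hab.symm⟩ ha') _
      ((Γ.contract b hb).card_contract _ ha' (Γ.card_contract b hb hm)))
    exact cls_iso K (OGraph.Iso.ofComm Γ a b hab ha hb hb' ha' g1 g2 g3) _ _
  · have h' : ¬ ∃ hb : Γ.Contractible b, (Γ.contract b hb).Contractible ⟨a, hab.symm⟩ :=
      fun ⟨hb, ha'⟩ => h (contractible_exchange Γ.toGraph hab.symm g2 g1 g3.symm hb ha')
    have h0 : ∀ (a b : Γ.H) (hab : Γ.φE b ≠ Γ.φE a),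
        (¬ ∃ ha : Γ.Contractible a, (Γ.contract a ha).Contractible ⟨b, hab⟩) →
          contractCls₂ K Γ hm a b hab = 0 := by
      intro a b hab h
      unfold contractCls₂
      split_ifs with h1
      · exact contractCls_neg K _ _ fun h2 => h ⟨h1, h2⟩
      · rfl
    rw [h0 _ _ _ h, h0 _ _ _ h', neg_zero]

lemma contractCls₂_loop {m : ℕ} (Γ : OGraph k) (hm : Nat.card Γ.E = m + 2) {a b : Γ.H}
    (hab : Γ.φE b ≠ Γ.φE a)
    (h : ∀ ha : Γ.Contractible a,
      (Γ.merge a ha.1 (Γ.φV b)).1 = (Γ.merge a ha.1 (Γ.φV (Γ.flip b))).1) :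
    contractCls₂ K Γ hm a b hab = 0 := by
  unfold contractCls₂
  split_ifs with h1
  · exact contractCls_neg K _ _ fun h2 => ((contractible_contract Γ.toGraph hab h1).1 h2).1 (h h1)
  · rfl

/-- Contracting two edges in the two possible orders. -/
lemma contractCls₂_symm {m : ℕ} (Γ : OGraph k) (hm : Nat.card Γ.E = m + 2) {a b : Γ.H}
    (hab : Γ.φE b ≠ Γ.φE a) :
    contractCls₂ K Γ hm a b hab = -contractCls₂ K Γ hm b a hab.symm := by
  have hfa := Γ.φE_flip a
  have hfb := Γ.φE_flip b
  have ea := contractCls₂_edge K Γ hm hab (a' := Γ.flip a) (b' := b) (by grind) hfa rfl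
  have eb := contractCls₂_edge K Γ hm hab (a' := a) (b' := Γ.flip b) (by grind) rfl hfb
  have eab := contractCls₂_edge K Γ hm hab (a' := Γ.flip a) (b' := Γ.flip b) (by grind) hfa hfb
  have ea' := contractCls₂_edge K Γ hm hab.symm (a' := b) (b' := Γ.flip a) (by grind) rfl hfa
  have eb' := contractCls₂_edge K Γ hm hab.symm (a' := Γ.flip b) (b' := a) (by grind) hfb rfl
  have eab' := contractCls₂_edge K Γ hm hab.symm (a' := Γ.flip b) (b' := Γ.flip a) (by grind)
    hfb hfa
  by_cases hl : Γ.φV a = Γ.φV (Γ.flip a) ∨ Γ.φV b = Γ.φV (Γ.flip b) ∨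
      (Γ.φV a = Γ.φV b ∧ Γ.φV (Γ.flip a) = Γ.φV (Γ.flip b)) ∨
      (Γ.φV a = Γ.φV (Γ.flip b) ∧ Γ.φV (Γ.flip a) = Γ.φV b)
  · rw [contractCls₂_loop K Γ hm hab, contractCls₂_loop K Γ hm hab.symm, neg_zero]
    · intro hb
      have := hb.1
      simp only [Graph.merge_val]
      grind
    · intro ha
      have := ha.1
      simp only [Graph.merge_val]
      grind
  · push Not at hl
    obtain ⟨l1, l2, l3, l4⟩ := hl
    have ffa := Γ.flip_flip a
    have ffb := Γ.flip_flip b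
    by_cases c1 : Γ.φV (Γ.flip a) = Γ.φV b
    · rw [← ea, ← ea']
      apply contractCls₂_generic <;> grind
    · by_cases c2 : Γ.φV (Γ.flip b) = Γ.φV a
      · rw [← eb, ← eb']
        apply contractCls₂_generic <;> grind
      · by_cases c3 : Γ.φV (Γ.flip a) = Γ.φV (Γ.flip b)
        · rw [← eab, ← eab']
          apply contractCls₂_generic <;> grind
        · exact contractCls₂_generic K Γ hm hab c1 c2 c3

lemma dChain_contractCls {m : ℕ} (Γ : OGraph k) (hm : Nat.card Γ.E = m + 2) (e : Γ.E) :
    dChain K k m (contractCls K Γ hm (Γ.half e)) = ∑ f : Γ.E, if hf : f ≠ e then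
      contractCls₂ K Γ hm (Γ.half e) (Γ.half f) (by rwa [Γ.φE_half, Γ.φE_half]) else 0 := by
  by_cases hc : Γ.Contractible (Γ.half e)
  · rw [contractCls_pos K _ _ hc, dChain_cls, boundary]
    have he := Γ.φE_half e
    rw [← Finset.sum_subset (Finset.subset_univ (Finset.univ.filter fun f => f ≠ e))
      (fun f _ hf => dif_neg (by simpa using hf))]
    refine Finset.sum_bij' (fun (f : (Γ.contract (Γ.half e) hc).E) _ =>
        (Subtype.val : {f : Γ.E // f ≠ Γ.φE (Γ.half e)} → Γ.E) f)
      (fun f hf => (⟨f, by simpa [he] using hf⟩ : {f : Γ.E // f ≠ Γ.φE (Γ.half e)}))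
      ?_ (fun _ _ => Finset.mem_univ _) (fun _ _ => rfl) (fun _ _ => rfl) ?_
    · intro f _
      have hf : f.1 ≠ e := fun h => f.2 (h.trans he.symm)
      exact Finset.mem_filter.2 ⟨Finset.mem_univ _, hf⟩
    · intro f _
      have hf : f.1 ≠ e := fun h => f.2 (h.trans he.symm)
      rw [dif_pos hf, contractCls₂, dif_pos hc]
      apply contractCls_edge
      refine ((Γ.contract (Γ.half e) hc).φE_half f).trans ?_
      exact Subtype.ext (Γ.φE_half _).symm
  · rw [contractCls_neg K _ _ hc, map_zero]
    symm
    refine Finset.sum_eq_zero (fun f _ => ?_)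
    split_ifs
    · exact dif_neg hc
    · rfl

theorem dChain_dChain (m : ℕ) (x : Chain K k (m + 2)) :
    dChain K k m (dChain K k (m + 1) x) = 0 := by
  refine chain_induction K (p := fun x => dChain K k m (dChain K k (m + 1) x) = 0) x
    (by rw [map_zero, map_zero]) (fun x y hx hy => by rw [map_add, map_add, hx, hy, add_zero])
    (fun c x hx => by rw [map_smul, map_smul, hx, smul_zero]) (fun Γ hm => ?_)
  rw [dChain_cls, boundary, map_sum]
  simp only [dChain_contractCls]
  rw [← Finset.sum_product']
  refine Finset.sum_involution (fun p _ => (p.2, p.1)) ?_ ?_ (fun _ _ => Finset.mem_univ _)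
    (fun _ _ => rfl)
  · rintro ⟨e, f⟩ -
    by_cases hf : f = e
    · simp [hf]
    · simp only [ne_eq, hf, Ne.symm hf, not_false_eq_true, dite_true]
      rw [contractCls₂_symm, neg_add_cancel]
  · rintro ⟨e, f⟩ - h1 h2
    simp only [Prod.mk.injEq] at h2
    exact h1 (by simp [h2.1])

variable (k)

/-- The underlying space of the curved graph complex: possibly infinite linear combinations of
isomorphism classes of oriented (ribbon) graphs, i.e. the completion with respect to the number of
edges. -/
def Curved : Type _ := ∀ m : ℕ, Chain K k m

instance : AddCommGroup (Curved K k) := inferInstanceAs (AddCommGroup (∀ m : ℕ, Chain K k m))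

instance : Module K (Curved K k) := inferInstanceAs (Module K (∀ m : ℕ, Chain K k m))

/-- The differential `d Γ = ∑ₑ d_e Γ`, extended to infinite linear combinations. -/
def diff : Curved K k →ₗ[K] Curved K k where
  toFun x m := dChain K k m (x (m + 1))
  map_add' x y := funext fun m => map_add (dChain K k m) (x (m + 1)) (y (m + 1))
  map_smul' c x := funext fun m => map_smul (dChain K k m) c (x (m + 1))

theorem diff_comp_diff : (diff K k).comp (diff K k) = 0 := by
  ext1 x
  funext m
  exact dChain_dChain K m (x (m + 2))

/-- The span of the oriented graphs with `m` edges all of whose vertices have valence at least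
two. -/
def uncurvedChain (m : ℕ) : Submodule K (Chain K k m) :=
  Submodule.span K {z | ∃ (Γ : OGraph k) (hm : Nat.card Γ.E = m),
    (∀ v, 2 ≤ Γ.valence v) ∧ z = cls K Γ hm}

/-- The underlying space of Kontsevich's (uncurved) graph complex: the possibly infinite linear
combinations of graphs all of whose vertices have valence at least two. -/
def uncurved : Submodule K (Curved K k) where
  carrier := {x | ∀ m, x m ∈ uncurvedChain K k m}
  add_mem' hx hy m := (uncurvedChain K k m).add_mem (hx m) (hy m)
  zero_mem' m := (uncurvedChain K k m).zero_mem
  smul_mem' c _ hx m := (uncurvedChain K k m).smul_mem c (hx m)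

variable {k} in
lemma boundary_mem {m : ℕ} (Γ : OGraph k) (hm : Nat.card Γ.E = m + 1)
    (hv : ∀ v, 2 ≤ Γ.valence v) :
    boundary K Γ hm ∈ uncurvedChain K k m := by
  refine Submodule.sum_mem _ (fun e _ => ?_)
  by_cases hc : Γ.Contractible (Γ.half e)
  · rw [contractCls_pos K _ _ hc]
    exact Submodule.subset_span ⟨_, _, Γ.two_le_valence_contract _ hc hv, rfl⟩
  · rw [contractCls_neg K _ _ hc]
    exact Submodule.zero_mem _

lemma diff_mem_uncurved (x : Curved K k) (hx : x ∈ uncurved K k) :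
    diff K k x ∈ uncurved K k := by
  intro m
  have hxm := hx (m + 1)
  change dChain K k m (x (m + 1)) ∈ _
  generalize x (m + 1) = y at hxm ⊢
  induction hxm using Submodule.span_induction with
  | mem z hz =>
    obtain ⟨Γ, hm, hv, rfl⟩ := hz
    rw [dChain_cls]
    exact boundary_mem K Γ hm hv
  | zero => rw [map_zero]; exact Submodule.zero_mem _
  | add z w _ _ hz hw => rw [map_add]; exact Submodule.add_mem _ hz hw
  | smul c z _ hz => rw [map_smul]; exact Submodule.smul_mem _ _ hz

/-- The differential of the uncurved graph complex, the restriction of `diff`. -/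
def diffUncurved : uncurved K k →ₗ[K] uncurved K k :=
  (diff K k).restrict (diff_mem_uncurved K k)

theorem diffUncurved_comp_diffUncurved : (diffUncurved K k).comp (diffUncurved K k) = 0 := by
  ext1 x
  exact Subtype.ext (LinearMap.congr_fun (diff_comp_diff K k) x.1)

section Homology

variable {K}
variable {M N : Type*} [AddCommGroup M] [Module K M] [AddCommGroup N] [Module K N]

/-- The homology `ker d / im d` of a vector space with a differential. -/
abbrev Homology (d : M →ₗ[K] M) : Type _ :=
  LinearMap.ker d ⧸ (LinearMap.range d).submoduleOf (LinearMap.ker d)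

/-- The map induced on homology by a linear map which commutes with the differentials. -/
def homologyMap (d : M →ₗ[K] M) (d' : N →ₗ[K] N) (f : M →ₗ[K] N)
    (hf : f.comp d = d'.comp f) : Homology d →ₗ[K] Homology d' :=
  Submodule.mapQ _ _
    (f.restrict (p := LinearMap.ker d) (q := LinearMap.ker d') fun x hx => by
      have h := LinearMap.congr_fun hf x
      simp only [LinearMap.comp_apply, LinearMap.mem_ker.1 hx, map_zero] at h
      exact h.symm)
    (by
      rintro ⟨x, hx⟩ ⟨y, hy⟩
      exact ⟨f y, (LinearMap.congr_fun hf y).symm.trans (congrArg f hy)⟩)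

end Homology

/-- The map on homology induced by the inclusion of Kontsevich's (ribbon) graph complex into the
curved (ribbon) graph complex. -/
def inclusionOnHomology : Homology (diffUncurved K k) →ₗ[K] Homology (diff K k) :=
  homologyMap (diffUncurved K k) (diff K k) (uncurved K k).subtype rfl

end

end CurvedGraph

namespace CurvedGraph

noncomputable section

open scoped Classical
open Equiv (swap Perm)

namespace TotalOrdering

variable {X Y Z : Type}

instance nonempty_of_finite [Finite X] : Nonempty (TotalOrdering X) :=
  have := Fintype.ofFinite X
  ⟨⟨Finset.univ.toList, Finset.nodup_toList _, fun x => by simp⟩⟩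

lemma map_map (l : TotalOrdering X) (e : X ≃ Y) (f : Y ≃ Z) :
    (l.map e).map f = l.map (e.trans f) := by
  ext1
  simp [map]

lemma map_injective (l : TotalOrdering X) {e f : X ≃ Y} (h : l.map e = l.map f) : e = f := by
  have h' : l.toList.map e = l.toList.map f := congrArg toList h
  ext x
  exact List.map_inj_left.1 h' x (l.complete x)

lemma exists_map_eq (l l' : TotalOrdering X) : ∃ π : Perm X, l' = l.map π := by
  have hp : l.toList.Perm l'.toList :=
    (List.perm_ext_iff_of_nodup l.nodup l'.nodup).2 fun x => by simp [l.complete, l'.complete]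
  refine ⟨(l.nodup.getEquivOfForallMemList _ l.complete).symm.trans
    ((finCongr hp.length_eq).trans (l'.nodup.getEquivOfForallMemList _ l'.complete)), ?_⟩
  ext1
  refine List.ext_getElem (by simp [map, hp.length_eq]) fun i h1 h2 => ?_
  have hi : i < l.toList.length := by rwa [hp.length_eq]
  have := (l.nodup.getEquivOfForallMemList _ l.complete).symm_apply_apply ⟨i, hi⟩
  simp only [map, List.getElem_map, Equiv.trans_apply]
  rw [show l.toList[i] = l.nodup.getEquivOfForallMemList _ l.complete ⟨i, hi⟩ from rfl, this]
  rfl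

/-- The sign of the permutation which carries one ordering to another one. -/
def relSign [Fintype X] (l l' : TotalOrdering X) : ℤˣ := Perm.sign (exists_map_eq l l').choose

lemma relSign_map [Fintype X] (l : TotalOrdering X) (π : Perm X) :
    relSign l (l.map π) = Perm.sign π := by
  rw [relSign, l.map_injective (exists_map_eq l (l.map π)).choose_spec.symm]

lemma relSign_self [Fintype X] (l : TotalOrdering X) : l.relSign l = 1 := by
  rw [relSign, l.map_injective (f := Equiv.refl X)
    ((exists_map_eq l l).choose_spec.symm.trans (by ext1; simp [map])), Perm.sign_refl]

lemma relSign_map_swap [Fintype X] (l l' : TotalOrdering X) {x y : X} (h : x ≠ y) :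
    relSign l (l'.map (swap x y)) = -relSign l l' := by
  obtain ⟨π, rfl⟩ := exists_map_eq l l'
  rw [map_map, relSign_map, relSign_map, ← Perm.mul_def, Perm.sign_mul, Perm.sign_swap h,
    neg_one_mul]

end TotalOrdering

namespace Graph

instance finiteV (Γ : Graph) : Finite Γ.V := Finite.of_surjective _ Γ.φV_surj

instance fintypeV (Γ : Graph) : Fintype Γ.V := Fintype.ofFinite _

instance fintypeH (Γ : Graph) : Fintype Γ.H := Fintype.ofFinite _

namespace Orientation

variable {Γ Δ : Graph}

lemma sign_swap_H (o : Γ.Orientation) {inst : DecidableEq Γ.H} {x y : Γ.H} (hxy : x ≠ y)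
    (l : TotalOrdering Γ.H) (w : TotalOrdering Γ.V) :
    o.sign (l.map (@swap _ inst x y)) w = -o.sign l w := by
  rw [Subsingleton.elim inst, o.swap_H x y hxy]

lemma sign_swap_V (o : Γ.Orientation) {inst : DecidableEq Γ.V} {x y : Γ.V} (hxy : x ≠ y)
    (l : TotalOrdering Γ.H) (w : TotalOrdering Γ.V) :
    o.sign l (w.map (@swap _ inst x y)) = -o.sign l w := by
  rw [Subsingleton.elim inst, o.swap_V x y hxy]

lemma sign_map_H (o : Γ.Orientation) (π : Perm Γ.H) (l : TotalOrdering Γ.H)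
    (w : TotalOrdering Γ.V) : o.sign (l.map π) w = Perm.sign π * o.sign l w := by
  induction π using Perm.swap_induction_on with
  | one =>
    rw [map_one, one_mul]
    congr 1
    ext1
    simp [TotalOrdering.map]
  | swap_mul π x y hxy ih =>
    rw [Perm.mul_def, ← TotalOrdering.map_map, o.swap_H x y hxy, ih, ← Perm.mul_def,
      Perm.sign_mul, Perm.sign_swap hxy, neg_one_mul, neg_mul]

lemma sign_map_V (o : Γ.Orientation) (π : Perm Γ.V) (l : TotalOrdering Γ.H)
    (w : TotalOrdering Γ.V) : o.sign l (w.map π) = Perm.sign π * o.sign l w := by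
  induction π using Perm.swap_induction_on with
  | one =>
    rw [map_one, one_mul]
    congr 1
    ext1
    simp [TotalOrdering.map]
  | swap_mul π x y hxy ih =>
    rw [Perm.mul_def, ← TotalOrdering.map_map, o.swap_V x y hxy, ih, ← Perm.mul_def,
      Perm.sign_mul, Perm.sign_swap hxy, neg_one_mul, neg_mul]

/-- The orientation with a given sign on one pair of orderings. -/
def ofBase (l₀ : TotalOrdering Γ.H) (w₀ : TotalOrdering Γ.V) (ε : ℤˣ) : Γ.Orientation where
  sign l w := ε * l₀.relSign l * w₀.relSign w
  swap_H x y hxy l w := by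
    rw [TotalOrdering.relSign_map_swap _ _ hxy, mul_neg, neg_mul]
  swap_V x y hxy l w := by
    rw [TotalOrdering.relSign_map_swap _ _ hxy, mul_neg]

lemma ofBase_sign (l₀ : TotalOrdering Γ.H) (w₀ : TotalOrdering Γ.V) (ε : ℤˣ) :
    (ofBase l₀ w₀ ε).sign l₀ w₀ = ε := by
  simp [ofBase, TotalOrdering.relSign_self]

/-- Compatibility of bijections with orientations can be checked on one pair of orderings. -/
lemma sign_comm_of_eq (o : Γ.Orientation) (o' : Δ.Orientation) (e : Γ.H ≃ Δ.H) (f : Γ.V ≃ Δ.V)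
    {l₀ : TotalOrdering Γ.H} {w₀ : TotalOrdering Γ.V}
    (h : o'.sign (l₀.map e) (w₀.map f) = o.sign l₀ w₀) (l : TotalOrdering Γ.H)
    (w : TotalOrdering Γ.V) : o'.sign (l.map e) (w.map f) = o.sign l w := by
  obtain ⟨π, rfl⟩ := l₀.exists_map_eq l
  obtain ⟨ρ, rfl⟩ := w₀.exists_map_eq w
  have h1 : (l₀.map π).map e = (l₀.map e).map (e.permCongr π) := by
    ext1
    simp [TotalOrdering.map]
  have h2 : (w₀.map ρ).map f = (w₀.map f).map (f.permCongr ρ) := by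
    ext1
    simp [TotalOrdering.map]
  rw [h1, h2, sign_map_H, sign_map_V, sign_map_H, sign_map_V, h, Perm.sign_permCongr,
    Perm.sign_permCongr]

end Orientation

end Graph

lemma sign_eq_sign {X : Type} (d d' : DecidableEq X) (f f' : Fintype X) (π : Perm X) :
    @Perm.sign X d f π = @Perm.sign X d' f' π := by
  rw [Subsingleton.elim d d', Subsingleton.elim f f']

lemma mergeCycles_apply {X : Type} (σ : Perm X) {a b x : X} (hab : a ≠ b) (ha : x ≠ a)
    (hb : x ≠ b) : mergeCycles σ a b x =
      if (if σ x = a then σ b else σ x) = b then (if σ a = a then σ b else σ a)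
      else (if σ x = a then σ b else σ x) := by
  rw [mergeCycles, skip_apply _ hb, skip_apply _ ha, skip_apply _ hab.symm]
  simp [Equiv.swap_apply_of_ne_of_ne ha hb]

/-- Insert `inr true` after `x` in its cycle, and fix `inr false`. -/
def insertAfter {X : Type} (σ : Perm X) (x : X) : Perm (X ⊕ Bool) :=
  (Equiv.sumCongr σ (1 : Perm Bool) : Perm (X ⊕ Bool)) *
    @swap _ (fun _ _ => Classical.propDecidable _) (Sum.inl x) (Sum.inr true)

namespace TotalOrdering

variable {X Y : Type}

/-- The ordering which starts with two additional elements. -/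
def hair (l : TotalOrdering X) : TotalOrdering (X ⊕ Bool) where
  toList := Sum.inr true :: Sum.inr false :: l.toList.map Sum.inl
  nodup := by simpa using l.nodup.map Sum.inl_injective
  complete := by
    rintro (z | _ | _)
    · simpa using l.complete z
    · simp
    · simp

/-- The ordering which starts with an additional element. -/
def optionCons (w : TotalOrdering X) : TotalOrdering (Option X) where
  toList := none :: w.toList.map some
  nodup := by simpa using w.nodup.map (Option.some_injective _)
  complete := by
    rintro (_ | v)
    · exact List.mem_cons_self
    · exact List.mem_cons_of_mem _ (List.mem_map_of_mem (w.complete v))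

lemma hair_map (l : TotalOrdering X) (e : X ≃ Y) :
    (l.map e).hair = l.hair.map (e.sumCongr (Equiv.refl Bool)) := by
  ext1
  simp [hair, map]

lemma optionCons_map (w : TotalOrdering X) (e : X ≃ Y) :
    (w.map e).optionCons = w.optionCons.map e.optionCongr := by
  ext1
  simp [optionCons, map]

lemma hair_toList_map {f : X → Y} (l : TotalOrdering X) : l.hair.toList.map (Sum.map f id) =
    Sum.inr true :: Sum.inr false :: l.toList.map fun z => Sum.inl (f z) := by
  simp [hair]

lemma optionCons_toList_map {f : X → Y} (l : TotalOrdering X) :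
    l.optionCons.toList.map (Option.map f) = none :: l.toList.map fun z => some (f z) := by
  simp [optionCons]

lemma map_refl (l : TotalOrdering X) : l.map (Equiv.refl X) = l := by
  ext1
  simp [map]

end TotalOrdering

section InsertAfter

variable {X : Type} (σ : Perm X) (x : X)

lemma insertAfter_inl (z : X) :
    insertAfter σ x (Sum.inl z) = if z = x then Sum.inr true else Sum.inl (σ z) := by
  by_cases hz : z = x
  · simp [insertAfter, hz]
  · rw [insertAfter, Perm.mul_apply, @Equiv.swap_apply_of_ne_of_ne _ (_) _ _ _
      (by simpa using hz) (by simp), if_neg hz]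
    rfl

lemma insertAfter_true : insertAfter σ x (Sum.inr true) = Sum.inl (σ x) := by
  simp [insertAfter]

lemma insertAfter_false : insertAfter σ x (Sum.inr false) = Sum.inr false := by
  rw [insertAfter, Perm.mul_apply, @Equiv.swap_apply_of_ne_of_ne _ (_) _ _ _ (by simp) (by simp)]
  rfl

lemma insertAfter_comm {Y : Type} {τ : Perm Y} {e : X → Y} (he : Function.Injective e)
    (h : ∀ z, τ (e z) = e (σ z)) (z : X ⊕ Bool) :
    insertAfter τ (e x) (Sum.map e id z) = Sum.map e id (insertAfter σ x z) := by
  rcases z with z | z | z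
  · simp only [Sum.map_inl, insertAfter_inl, he.eq_iff, h]
    split_ifs <;> simp
  · simp [insertAfter_false]
  · simp [insertAfter_true, h]

end InsertAfter

namespace Graph

/-- Attach a hair at the vertex of the half-edge `x`: a new edge with halves `inr true`, attached to
the vertex of `x`, and `inr false`, attached to a new vertex. -/
abbrev attach (Γ : Graph) (x : Γ.H) : Graph where
  H := Γ.H ⊕ Bool
  V := Option Γ.V
  E := Option Γ.E
  finite_H := inferInstance
  nonempty_V := inferInstance
  φV := Sum.elim (fun z => some (Γ.φV z)) fun b => if b then some (Γ.φV x) else none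
  φE := Sum.elim (fun z => some (Γ.φE z)) fun _ => none
  φV_surj := by
    rintro (_ | v)
    · exact ⟨Sum.inr false, by simp⟩
    · obtain ⟨z, rfl⟩ := Γ.φV_surj v
      exact ⟨Sum.inl z, rfl⟩
  φE_surj := by
    rintro (_ | e)
    · exact ⟨Sum.inr false, rfl⟩
    · obtain ⟨z, rfl⟩ := Γ.φE_surj e
      exact ⟨Sum.inl z, rfl⟩
  φE_fiber := by
    rintro (_ | e)
    · rw [show (2 : ℕ) = (Set.range (Sum.inr : Bool → Γ.H ⊕ Bool)).ncard by
        rw [← Set.image_univ, Set.ncard_image_of_injective _ Sum.inr_injective]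
        simp]
      congr 1
      ext (z | z) <;> simp
    · rw [← Γ.φE_fiber e,
        ← Set.ncard_image_of_injective _ (Sum.inl_injective : Function.Injective
          (Sum.inl : Γ.H → Γ.H ⊕ Bool))]
      congr 1
      ext (z | z) <;> simp

section

variable (Γ : Graph) (x : Γ.H)

lemma attach_flip_inl (z : Γ.H) : (Γ.attach x).flip (Sum.inl z) = Sum.inl (Γ.flip z) :=
  ((Γ.attach x).flip_unique (h := Sum.inl z) (x := Sum.inl (Γ.flip z))
    (congrArg some (Γ.φE_flip z)) fun h => Γ.flip_ne z (Sum.inl_injective h)).symm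

lemma attach_flip_true : (Γ.attach x).flip (Sum.inr true) = Sum.inr false :=
  ((Γ.attach x).flip_unique (h := Sum.inr true) (x := Sum.inr false) rfl
    fun h => Bool.false_ne_true (Sum.inr_injective h)).symm

end

/-- The orientation which induces the given one upon contraction of the hair. -/
def Orientation.attach {Γ : Graph} (o : Γ.Orientation) (x : Γ.H) : (Γ.attach x).Orientation :=
  Orientation.ofBase (Γ := Γ.attach x) (Classical.arbitrary (TotalOrdering Γ.H)).hair
    (Classical.arbitrary (TotalOrdering Γ.V)).optionCons
    (-o.sign (Classical.arbitrary _) (Classical.arbitrary _))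

lemma Orientation.attach_sign {Γ : Graph} (o : Γ.Orientation) (x : Γ.H) (l : TotalOrdering Γ.H)
    (w : TotalOrdering Γ.V) : (o.attach x).sign l.hair w.optionCons = -o.sign l w := by
  have base := Orientation.ofBase_sign (Γ := Γ.attach x)
    (Classical.arbitrary (TotalOrdering Γ.H)).hair
    (Classical.arbitrary (TotalOrdering Γ.V)).optionCons
    (-o.sign (Classical.arbitrary _) (Classical.arbitrary _))
  obtain ⟨π, hπ⟩ := (Classical.arbitrary (TotalOrdering Γ.H)).exists_map_eq l
  obtain ⟨ρ, hρ⟩ := (Classical.arbitrary (TotalOrdering Γ.V)).exists_map_eq w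
  have s1 := Perm.sign_sumCongr π (1 : Perm Bool)
  rw [map_one, mul_one] at s1
  rw [hπ, hρ, TotalOrdering.hair_map, TotalOrdering.optionCons_map, o.sign_map_H, o.sign_map_V]
  refine ((o.attach x).sign_map_H _ _ _).trans ?_
  refine (congrArg _ ((o.attach x).sign_map_V _ _ _)).trans ?_
  refine (congrArg _ (congrArg _ base)).trans ?_
  rw [mul_neg, mul_neg]
  exact congrArg Neg.neg (congrArg₂ _ ((sign_eq_sign _ _ _ _ _).trans s1)
    (congrArg₂ _ ((sign_eq_sign _ _ _ _ _).trans (Equiv.optionCongr_sign ρ)) rfl))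

/-- The orientation of a graph with a hair, evaluated on orderings which start with another edge. -/
lemma Orientation.attach_sign_extend {Γ : Graph} (o : Γ.Orientation) (y h : Γ.H)
    (l : TotalOrdering (Γ.RestH h)) (w : TotalOrdering (Γ.MergedV h))
    (L : TotalOrdering (Γ.attach y).H) (W : TotalOrdering (Γ.attach y).V)
    (hL : L.toList = Sum.inl h :: Sum.inl (Γ.flip h) :: Sum.inr true :: Sum.inr false ::
      l.toList.map fun z => Sum.inl z.1)
    (hW : W.toList = some (Γ.φV (Γ.flip h)) :: none :: w.toList.map fun v => some v.1) :
    (o.attach y).sign L W = o.sign (Γ.extendH h l) (TotalOrdering.cons (Γ.φV (Γ.flip h)) w) := by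
  have h1 := Γ.flip_ne h
  have eL : L = ((Γ.extendH h l).hair.map
      (swap (Sum.inl h : Γ.H ⊕ Bool) (Sum.inr true) : Perm (Γ.H ⊕ Bool))).map
        (swap (Sum.inl (Γ.flip h) : Γ.H ⊕ Bool) (Sum.inr false) : Perm (Γ.H ⊕ Bool)) := by
    apply TotalOrdering.ext
    rw [hL]
    change _ = List.map _ (List.map _ (_ :: _ :: List.map _ (_ :: _ :: List.map _ _)))
    simp only [List.map_cons, List.map_map, Equiv.swap_apply_left, Equiv.swap_apply_right]
    rw [Equiv.swap_apply_of_ne_of_ne (a := Sum.inl h) (b := Sum.inr true) (x := Sum.inr false)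
        (by simp) (by simp), Equiv.swap_apply_right,
      Equiv.swap_apply_of_ne_of_ne (a := Sum.inl h) (b := Sum.inr true) (x := Sum.inl (Γ.flip h))
        (by simpa using h1) (by simp), Equiv.swap_apply_left,
      Equiv.swap_apply_of_ne_of_ne (by simpa using h1.symm) (by simp),
      Equiv.swap_apply_of_ne_of_ne (by simp) (by simp)]
    refine congrArg (fun z => _ :: _ :: _ :: _ :: z) (List.map_congr_left fun z _ => ?_)
    have hz := z.2
    have h2 := Γ.φE_flip h
    simp only [Function.comp]
    rw [Equiv.swap_apply_of_ne_of_ne (a := Sum.inl h) (by simp; grind) (by simp),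
      Equiv.swap_apply_of_ne_of_ne (by simp; grind) (by simp)]
  have eW : W = ((TotalOrdering.cons (Γ.φV (Γ.flip h)) w).optionCons).map
      (swap (some (Γ.φV (Γ.flip h))) none : Perm (Option Γ.V)) := by
    apply TotalOrdering.ext
    rw [hW]
    change _ = List.map _ (_ :: List.map _ (_ :: List.map _ _))
    simp only [List.map_cons, List.map_map, Equiv.swap_apply_left, Equiv.swap_apply_right]
    refine congrArg (fun z => _ :: _ :: z) (List.map_congr_left fun v _ => ?_)
    simp only [Function.comp]
    rw [Equiv.swap_apply_of_ne_of_ne (by simpa using v.2) (by simp)]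
  rw [eL, eW]
  refine ((o.attach y).sign_swap_V (Option.some_ne_none _) _ _).trans ?_
  refine (congrArg Neg.neg ((o.attach y).sign_swap_H Sum.inl_ne_inr _ _)).trans ?_
  refine (congrArg (fun z => - -z) ((o.attach y).sign_swap_H Sum.inl_ne_inr _ _)).trans ?_
  rw [o.attach_sign]
  simp

/-- The ribbon structure with the hair placed directly after `x`. -/
def CyclicOrdering.attach {Γ : Graph} (c : Γ.CyclicOrdering) (x : Γ.H) :
    (Γ.attach x).CyclicOrdering where
  next := insertAfter c.next x
  sameCycle_iff y z := by
    have h0 : ∀ n : ℤ, ∀ u : Γ.H, ((Equiv.sumCongr c.next (1 : Perm Bool) : Perm (Γ.H ⊕ Bool)) ^ n)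
        (Sum.inl u) = Sum.inl ((c.next ^ n) u) := by
      intro n u
      have := map_zpow (Perm.sumCongrHom Γ.H Bool) (c.next, 1) n
      rw [Prod.pow_mk, one_zpow] at this
      exact (congrArg (fun p : Perm (Γ.H ⊕ Bool) => p (Sum.inl u)) this).symm
    have h1 : ∀ n : ℤ, ∀ b : Bool,
        ((Equiv.sumCongr c.next (1 : Perm Bool) : Perm (Γ.H ⊕ Bool)) ^ n) (Sum.inr b) =
          Sum.inr b := by
      intro n u
      have := map_zpow (Perm.sumCongrHom Γ.H Bool) (c.next, 1) n
      rw [Prod.pow_mk, one_zpow] at this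
      exact (congrArg (fun p : Perm (Γ.H ⊕ Bool) => p (Sum.inr u)) this).symm
    have hσ : ∀ u v, Perm.SameCycle
        (Equiv.sumCongr c.next (1 : Perm Bool) : Perm (Γ.H ⊕ Bool)) u v ↔
        Sum.map Γ.φV id u = Sum.map Γ.φV id v := by
      rintro (u | u) (v | v)
      · simp only [Perm.SameCycle, h0, Sum.map_inl, Sum.inl.injEq]
        exact c.sameCycle_iff u v
      · simp [Perm.SameCycle, h0]
      · simp [Perm.SameCycle, h1]
      · simp [Perm.SameCycle, h1]
    refine (sameCycle_swap hσ (a := Sum.inl x) (b := Sum.inr true) (by simp) y z).trans ?_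
    change _ ↔ (Sum.elim (fun z => some (Γ.φV z)) (fun b => if b then some (Γ.φV x) else none) y :
      Option Γ.V) = Sum.elim (fun z => some (Γ.φV z)) (fun b => if b then some (Γ.φV x) else none) z
    rcases y with y | _ | _ <;> rcases z with z | _ | _ <;> simp

end Graph

namespace OGraph

variable {k : Kind}

/-- Attach a hair directly after the half-edge `x`. -/
abbrev attach (Γ : OGraph k) (x : Γ.H) : OGraph k where
  toGraph := Γ.toGraph.attach x
  cyc hr := (Γ.cyc hr).attach x
  orient := Γ.orient.attach x

lemma card_attach (Γ : OGraph k) (x : Γ.H) {m : ℕ} (hm : Nat.card Γ.E = m) :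
    Nat.card (Γ.attach x).E = m + 1 := by
  rw [← hm]
  exact Finite.card_option

namespace Iso

variable {Γ Δ : OGraph k}

/-- An isomorphism extends to the graphs with corresponding hairs attached. -/
def attach (i : Iso Γ Δ) (x : Γ.H) : Iso (Γ.attach x) (Δ.attach (i.onH x)) where
  onH := i.onH.sumCongr (Equiv.refl Bool)
  onV := i.onV.optionCongr
  onE := i.onE.optionCongr
  φV_comm := by
    rintro (z | _ | _)
    · exact congrArg some (i.φV_comm z)
    · rfl
    · exact congrArg some (i.φV_comm x)
  φE_comm := by
    rintro (z | z)
    · exact congrArg some (i.φE_comm z)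
    · rfl
  cyc_comm hr z := insertAfter_comm _ x i.onH.injective (i.cyc_comm hr) z
  sign_comm := by
    obtain ⟨l⟩ : Nonempty (TotalOrdering Γ.H) := inferInstance
    obtain ⟨w⟩ : Nonempty (TotalOrdering Γ.V) := inferInstance
    refine Graph.Orientation.sign_comm_of_eq _ _ _ _ (l₀ := l.hair) (w₀ := w.optionCons) ?_
    refine Eq.trans ?_ (((Δ.orient.attach_sign (i.onH x) (l.map i.onH) (w.map i.onV)).trans
      (congrArg Neg.neg (i.sign_comm l w))).trans (Γ.orient.attach_sign x l w).symm)
    exact congrArg₂ _ (l.hair_map i.onH).symm (w.optionCons_map i.onV).symm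

/-- Attaching a hair is compatible with reversing the orientation. -/
def attachOpp (Γ : OGraph k) (x : Γ.H) : Iso (Γ.opp.attach x) (Γ.attach x).opp where
  onH := Equiv.refl _
  onV := Equiv.refl _
  onE := Equiv.refl _
  φV_comm _ := rfl
  φE_comm _ := rfl
  cyc_comm _ _ := rfl
  sign_comm := by
    obtain ⟨l⟩ : Nonempty (TotalOrdering Γ.H) := inferInstance
    obtain ⟨w⟩ : Nonempty (TotalOrdering Γ.V) := inferInstance
    refine Graph.Orientation.sign_comm_of_eq _ _ _ _ (l₀ := l.hair) (w₀ := w.optionCons) ?_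
    refine Eq.trans ?_ (Γ.opp.orient.attach_sign x l w).symm
    refine congrArg Neg.neg (Eq.trans ?_ (Γ.orient.attach_sign x l w))
    exact congrArg₂ _ l.hair.map_refl w.optionCons.map_refl

end Iso

end OGraph

namespace Graph

variable (Γ : Graph)

lemma attach_contractible_hair (x : Γ.H) : (Γ.attach x).Contractible (Sum.inr true) := by
  refine ⟨?_, Sum.inl x, Option.some_ne_none _, Or.inl rfl⟩
  rw [attach_flip_true]
  exact Option.some_ne_none _

/-- The half-edge `h` is the only one at its vertex. -/
def Alone (h : Γ.H) : Prop := ∀ z, Γ.φV z = Γ.φV h → z = h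

variable {Γ}

lemma attach_contractible_iff {y h : Γ.H} (hy : Γ.φE y ≠ Γ.φE h) :
    (Γ.attach y).Contractible (Sum.inl h) ↔ Γ.Contractible h := by
  unfold Contractible
  rw [attach_flip_inl]
  refine and_congr (not_congr (Option.some_injective _).eq_iff) ⟨?_, ?_⟩
  · rintro ⟨z | _ | _, h1, h2⟩
    · exact ⟨z, fun h => h1 (congrArg some h),
        h2.imp (fun h => Option.some_injective _ h) (fun h => Option.some_injective _ h)⟩
    · exact (h2.elim (fun h => Option.some_ne_none _ h.symm)
        (fun h => Option.some_ne_none _ h.symm)).elim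
    · exact ⟨y, hy, h2.imp (fun h => Option.some_injective _ h) (fun h => Option.some_injective _ h)⟩
  · rintro ⟨z, h1, h2⟩
    exact ⟨Sum.inl z, fun h => h1 (Option.some_injective _ h),
      h2.imp (congrArg some) (congrArg some)⟩

lemma ne_of_attach_contractible {x h : Γ.H} (hc : (Γ.attach x).Contractible (Sum.inl h)) :
    Γ.φV h ≠ Γ.φV (Γ.flip h) := by
  have := hc.1
  rw [attach_flip_inl] at this
  exact fun hl => this (congrArg some hl)

lemma attach_contractible_self {x h : Γ.H} (hx : Γ.φE x = Γ.φE h)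
    (hl : Γ.φV h ≠ Γ.φV (Γ.flip h)) : (Γ.attach x).Contractible (Sum.inl h) := by
  refine ⟨?_, Sum.inr true, (Option.some_ne_none _).symm, ?_⟩
  · rw [attach_flip_inl]
    exact fun h => hl (Option.some_injective _ h)
  · rw [attach_flip_inl]
    rcases Γ.eq_or_eq_flip hx with rfl | rfl
    · exact Or.inl rfl
    · exact Or.inr rfl

end Graph

lemma TotalOrdering.map_cons {X : Type} (a : X) (w : TotalOrdering {x // x ≠ a}) :
    (cons a w).toList.map (fun v => if v = a then none else some v) =
      none :: w.toList.map fun v => some v.1 := by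
  simp only [cons, List.map_cons, List.map_map, if_true]
  refine congrArg (fun z => _ :: z) (List.map_congr_left fun v _ => ?_)
  exact if_neg v.2

/-- The map on half-edges which replaces the edge of `h` by a hair. -/
def Graph.leafMap (Γ : Graph) (h z : Γ.H) : Γ.H ⊕ Bool :=
  if Γ.φE z = Γ.φE h then Sum.inr (decide (z = h)) else Sum.inl z

namespace Graph

variable (Γ : Graph) {h z : Γ.H}

lemma leafMap_self : Γ.leafMap h h = Sum.inr true := by simp [leafMap]

lemma leafMap_flip : Γ.leafMap h (Γ.flip h) = Sum.inr false := by
  simp [leafMap, Γ.φE_flip, Γ.flip_ne]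

lemma leafMap_of_ne (hz : Γ.φE z ≠ Γ.φE h) : Γ.leafMap h z = Sum.inl z := by simp [leafMap, hz]

lemma leafMap_injective (h : Γ.H) : Function.Injective (Γ.leafMap h) := by
  intro a b hab
  have h1 := Γ.eq_or_eq_flip (h := h) (x := a)
  have h2 := Γ.eq_or_eq_flip (h := h) (x := b)
  have h3 := Γ.flip_ne h
  simp only [leafMap] at hab
  split_ifs at hab with h4 h5 h6
  · have := Sum.inr_injective hab
    rw [decide_eq_decide] at this
    grind
  · exact Sum.inl_injective hab

lemma map_leafMap_extendH (l : TotalOrdering (Γ.RestH h)) :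
    (Γ.extendH h l).toList.map (Γ.leafMap h) =
      Sum.inr true :: Sum.inr false :: l.toList.map fun z => Sum.inl z.1 := by
  simp only [extendH, List.map_cons, List.map_map, leafMap_self, leafMap_flip]
  refine congrArg (fun z => _ :: _ :: z) (List.map_congr_left fun z _ => ?_)
  exact Γ.leafMap_of_ne z.2

lemma mergeCycles_leafMap {σ : Perm Γ.H} {x : Γ.H} (hx : Γ.φE x = Γ.φE h)
    (hσ : σ (Γ.flip h) = Γ.flip h) (z : Γ.H) :
    mergeCycles (insertAfter σ x) (Sum.inl h) (Sum.inl (Γ.flip h)) (Γ.leafMap h z) =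
      Γ.leafMap h (σ z) := by
  have hne := (Γ.flip_ne h).symm
  have hab : (Sum.inl h : Γ.H ⊕ Bool) ≠ Sum.inl (Γ.flip h) := by simpa using hne
  have hE : ∀ u, u ≠ h → u ≠ Γ.flip h → Γ.leafMap h u = Sum.inl u := fun u h1 h2 =>
    Γ.leafMap_of_ne fun h3 => (Γ.eq_or_eq_flip h3).elim h1 h2
  have hs : ∀ u, u ≠ Γ.flip h → σ u ≠ Γ.flip h := fun u h1 h2 => h1 (σ.injective (h2.trans hσ.symm))
  by_cases h2 : z = Γ.flip h
  · rw [h2, hσ, leafMap_flip, mergeCycles_apply _ hab (by simp) (by simp)]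
    simp [insertAfter_false]
  · have h3 := hs z h2
    have h4 := hs h hne
    by_cases h1 : z = h
    · rw [h1, leafMap_self, mergeCycles_apply _ hab (by simp) (by simp)]
      simp only [insertAfter_inl, insertAfter_true, Sum.inl.injEq]
      rcases Γ.eq_or_eq_flip hx with rfl | rfl
      · by_cases h5 : σ x = x
        · simp [h5, hσ, hne.symm, leafMap_self]
        · simp [h5, h4, hE _ h5 h4]
      · by_cases h5 : σ h = h
        · simp [h5, hσ, hne, leafMap_self]
        · simp [h5, hσ, hne, hne.symm, hE _ h5 h4]
    · rw [hE z h1 h2, mergeCycles_apply _ hab (by simpa using h1) (by simpa using h2)]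
      simp only [insertAfter_inl, hσ]
      rcases Γ.eq_or_eq_flip hx with rfl | rfl
      · by_cases h5 : σ z = x
        · simp [h5, h1, hne.symm, leafMap_self]
        · simp [h5, h1, h3, hE _ h5 h3]
      · by_cases h5 : σ z = h
        · simp [h5, h2, leafMap_self]
        · simp [h5, h2, h3, hE _ h5 h3]

end Graph

namespace OGraph

variable {k : Kind}

/-- A criterion for a graph to be isomorphic to a contraction of another one. -/
def Iso.toContract {Γ Δ : OGraph k} {h h' : Δ.H} (hh : Δ.flip h = h') (hc : Δ.Contractible h)
    (fH : Γ.H → Δ.H) (fV : Γ.V → Δ.V) (fE : Γ.E → Δ.E)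
    (injH : Function.Injective fH) (injV : Function.Injective fV) (injE : Function.Injective fE)
    (rH : ∀ z, (∃ u, fH u = z) ↔ Δ.φE z ≠ Δ.φE h) (rV : ∀ v, (∃ u, fV u = v) ↔ v ≠ Δ.φV h')
    (rE : ∀ e, (∃ u, fE u = e) ↔ e ≠ Δ.φE h)
    (hV : ∀ z, Δ.φV (fH z) = Δ.φV h' → fV (Γ.φV z) = Δ.φV h)
    (hV' : ∀ z, Δ.φV (fH z) ≠ Δ.φV h' → fV (Γ.φV z) = Δ.φV (fH z))
    (hE : ∀ z, Δ.φE (fH z) = fE (Γ.φE z))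
    (hcyc : ∀ hr z, mergeCycles (Δ.cyc hr).next h h' (fH z) = fH ((Γ.cyc hr).next z))
    (l₀ : TotalOrdering Γ.H) (w₀ : TotalOrdering Γ.V)
    (hs : ∀ L W, L.toList = h :: h' :: l₀.toList.map fH →
      W.toList = Δ.φV h' :: w₀.toList.map fV → Δ.orient.sign L W = -Γ.orient.sign l₀ w₀) :
    Iso Γ (Δ.contract h hc) where
  onH := Equiv.ofBijective (fun z => (⟨fH z, (rH _).1 ⟨z, rfl⟩⟩ : Δ.RestH h))
    ⟨fun a b hab => injH (congrArg Subtype.val hab), fun z =>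
      ((rH _).2 z.2).imp fun _ hu => Subtype.ext hu⟩
  onV := Equiv.ofBijective
    (fun v => (⟨fV v, by rw [hh]; exact (rV _).1 ⟨v, rfl⟩⟩ : Δ.MergedV h))
    ⟨fun a b hab => injV (congrArg Subtype.val hab), fun v =>
      ((rV v.1).2 (by rw [← hh]; exact v.2)).imp fun _ hu => Subtype.ext hu⟩
  onE := Equiv.ofBijective (fun e => (⟨fE e, (rE _).1 ⟨e, rfl⟩⟩ : {e : Δ.E // e ≠ Δ.φE h}))
    ⟨fun a b hab => injE (congrArg Subtype.val hab), fun e =>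
      ((rE _).2 e.2).imp fun _ hu => Subtype.ext hu⟩
  φV_comm z := by
    apply Subtype.ext
    refine (Δ.merge_val _ _ _).trans ?_
    subst hh
    by_cases hz : Δ.φV (fH z) = Δ.φV (Δ.flip h)
    · exact (if_pos hz).trans (hV z hz).symm
    · exact (if_neg hz).trans (hV' z hz).symm
  φE_comm z := Subtype.ext (hE z)
  cyc_comm hr z := by
    apply Subtype.ext
    refine Eq.trans ?_ (hcyc hr z)
    rw [← hh]
    rfl
  sign_comm := by
    refine Graph.Orientation.sign_comm_of_eq _ _ _ _ (l₀ := l₀) (w₀ := w₀) ?_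
    subst hh
    exact (congrArg Neg.neg (hs _ _ (congrArg (fun z => _ :: _ :: z) List.map_map)
      (congrArg (fun z => _ :: z) List.map_map))).trans (neg_neg _)

variable (Γ : OGraph k)

/-- Contracting the hair. -/
def Iso.contractHair (x : Γ.H) (hc : (Γ.attach x).Contractible (Sum.inr true)) :
    Iso Γ ((Γ.attach x).contract (Sum.inr true) hc) :=
  Iso.toContract (Γ.attach_flip_true x) hc Sum.inl some some Sum.inl_injective
    (Option.some_injective _) (Option.some_injective _)
    (by rintro (z | z) <;> simp) (by rintro (_ | v) <;> simp) (by rintro (_ | e) <;> simp)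
    (fun z hz => by simp at hz) (fun z _ => rfl) (fun z => rfl)
    (fun hr z => by
      refine (mergeCycles_apply _ (by simp) (by simp) (by simp)).trans ?_
      simp only [Graph.CyclicOrdering.attach, insertAfter_inl, insertAfter_true, insertAfter_false]
      by_cases hz : z = x <;> simp [hz])
    (Classical.arbitrary _) (Classical.arbitrary _)
    (fun L W hL hW => by
      rw [← Γ.orient.attach_sign x]
      exact congrArg₂ _ (TotalOrdering.ext hL) (TotalOrdering.ext hW))

lemma mergeCycles_insertAfter {X : Type} (σ : Perm X) {a b y : X} (hab : a ≠ b) (hya : y ≠ a)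
    (hyb : y ≠ b) : mergeCycles (insertAfter σ y) (Sum.inl a) (Sum.inl b) =
      insertAfter (mergeCycles σ a b) y := by
  have hab' : (Sum.inl a : X ⊕ Bool) ≠ Sum.inl b := by simpa using hab
  ext1 u
  rcases u with u | _ | _
  · rw [insertAfter_inl]
    by_cases h1 : u = a
    · rw [h1, if_neg hya.symm, mergeCycles_left _ hab, mergeCycles_left _ hab']
    by_cases h2 : u = b
    · rw [h2, if_neg hyb.symm, mergeCycles_right, mergeCycles_right]
    rw [mergeCycles_apply _ hab' (by simpa using h1) (by simpa using h2),
      mergeCycles_apply _ hab h1 h2]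
    simp only [insertAfter_inl, if_neg hya.symm, if_neg hyb.symm]
    by_cases h3 : u = y
    · simp [h3]
    · simp only [if_neg h3, Sum.inl.injEq]
      split_ifs <;> simp_all
  · rw [mergeCycles_apply _ hab' (by simp) (by simp)]
    simp [insertAfter_false]
  · rw [mergeCycles_apply _ hab' (by simp) (by simp), insertAfter_true, insertAfter_true,
      mergeCycles_apply _ hab hya hyb]
    simp only [insertAfter_inl, if_neg hya.symm, if_neg hyb.symm, Sum.inl.injEq]
    split_ifs <;> simp_all

/-- Attaching a hair and contracting an edge which does not contain the half-edge `y` at which it is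
attached. -/
def Iso.attachContract (h : Γ.H) (hc : Γ.Contractible h) (y : Γ.RestH h)
    (hc' : (Γ.attach y.1).Contractible (Sum.inl h)) :
    Iso ((Γ.contract h hc).attach y).opp ((Γ.attach y.1).contract (Sum.inl h) hc') :=
  Iso.toContract (Γ := ((Γ.contract h hc).attach y).opp) (Γ.attach_flip_inl y.1 h) hc'
    (Sum.map Subtype.val id : Γ.RestH h ⊕ Bool → Γ.H ⊕ Bool)
    (Option.map Subtype.val : Option (Γ.MergedV h) → Option Γ.V)
    (Option.map Subtype.val : Option {e : Γ.E // e ≠ Γ.φE h} → Option Γ.E)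
    (Function.Injective.sumMap Subtype.val_injective Function.injective_id)
    (Option.map_injective Subtype.val_injective)
    (Option.map_injective Subtype.val_injective)
    (by
      rintro (z | z)
      · refine Iff.trans ⟨?_, fun hz => ⟨Sum.inl ⟨z, hz⟩, rfl⟩⟩
          (Option.some_injective _).ne_iff.symm
        rintro ⟨u | u, hu⟩
        · rw [← Sum.inl_injective hu]
          exact u.2
        · exact (Sum.inr_ne_inl hu).elim
      · exact ⟨fun _ => (Option.some_ne_none _).symm, fun _ => ⟨Sum.inr z, rfl⟩⟩)
    (by
      rintro (_ | v)
      · exact ⟨fun _ => (Option.some_ne_none _).symm, fun _ => ⟨none, rfl⟩⟩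
      · refine Iff.trans ⟨?_, fun hz => ⟨some ⟨v, hz⟩, rfl⟩⟩
          (Option.some_injective _).ne_iff.symm
        rintro ⟨_ | u, hu⟩
        · exact (Option.some_ne_none _ hu.symm).elim
        · rw [← Option.some_injective _ hu]
          exact u.2)
    (by
      rintro (_ | v)
      · exact ⟨fun _ => (Option.some_ne_none _).symm, fun _ => ⟨none, rfl⟩⟩
      · refine Iff.trans ⟨?_, fun hz => ⟨some ⟨v, hz⟩, rfl⟩⟩
          (Option.some_injective _).ne_iff.symm
        rintro ⟨_ | u, hu⟩
        · exact (Option.some_ne_none _ hu.symm).elim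
        · rw [← Option.some_injective _ hu]
          exact u.2)
    (by
      have key : ∀ u : Γ.H, some (Γ.φV u) = some (Γ.φV (Γ.flip h)) →
          some (Γ.merge h hc.1 (Γ.φV u)).1 = some (Γ.φV h) := fun u hu => by
        rw [Graph.merge_val, if_pos (Option.some_injective _ hu)]
      rintro (z | _ | _) hz
      · exact key z.1 hz
      · exact (Option.some_ne_none _ hz.symm).elim
      · exact key y.1 hz)
    (by
      have key : ∀ u : Γ.H, some (Γ.φV u) ≠ some (Γ.φV (Γ.flip h)) →
          some (Γ.merge h hc.1 (Γ.φV u)).1 = some (Γ.φV u) := fun u hu => by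
        rw [Graph.merge_val, if_neg fun h => hu (congrArg some h)]
      rintro (z | _ | _) hz
      · exact key z.1 hz
      · rfl
      · exact key y.1 hz)
    (by rintro (z | z) <;> rfl)
    (fun hr z => by
      refine (DFunLike.congr_fun (mergeCycles_insertAfter _ (Γ.flip_ne h).symm
        (fun hh => y.2 (by rw [hh])) (fun hh => y.2 (by rw [hh, Γ.φE_flip]))) _).trans ?_
      exact insertAfter_comm (x := y) (Subtype.val_injective : Function.Injective
        (Subtype.val : Γ.RestH h → Γ.H)) (σ := ((Γ.contract h hc).cyc hr).next)
        (fun _ => rfl) z)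
    (Classical.arbitrary (TotalOrdering (Γ.contract h hc).H)).hair
    (Classical.arbitrary (TotalOrdering (Γ.contract h hc).V)).optionCons
    (fun L W hL hW => by
      refine Eq.trans ?_ ((neg_neg _).trans
        ((Γ.contract h hc).orient.attach_sign y _ _)).symm
      refine (Γ.orient.attach_sign_extend y.1 h _ _ _ _ 
        (hL.trans (congrArg (fun z => _ :: _ :: z) (TotalOrdering.hair_toList_map _)))
        (hW.trans (congrArg (fun z => _ :: z) (TotalOrdering.optionCons_toList_map _)))).trans
        (neg_neg _).symm)

/-- Attaching a hair at an end point of an edge with a univalent vertex, and contracting this edge: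
the hair takes the place of the edge. -/
def Iso.contractLeaf (x h : Γ.H) (hx : Γ.φE x = Γ.φE h) (hh : Γ.Alone (Γ.flip h))
    (hc : (Γ.attach x).Contractible (Sum.inl h)) :
    Iso Γ.opp ((Γ.attach x).contract (Sum.inl h) hc) :=
  Iso.toContract (Γ := Γ.opp) (Γ.attach_flip_inl x h) hc
    (Γ.leafMap h)
    (fun v => if v = Γ.φV (Γ.flip h) then none else some v)
    (fun e => if e = Γ.φE h then none else some e)
    (Γ.leafMap_injective h)
    (fun a b hab => by
      dsimp only at hab
      split_ifs at hab with h4 h5 h6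
      · rw [h4, h5]
      · exact Option.some_injective _ hab)
    (fun a b hab => by
      dsimp only at hab
      split_ifs at hab with h4 h5 h6
      · rw [h4, h5]
      · exact Option.some_injective _ hab)
    (by
      rintro (z | _ | _)
      · refine Iff.trans ⟨?_, fun hz => ⟨z, Γ.leafMap_of_ne hz⟩⟩
          (Option.some_injective _).ne_iff.symm
        rintro ⟨u, hu⟩
        change (if _ then _ else _) = _ at hu
        split_ifs at hu with h3
        rwa [← Sum.inl_injective hu]
      · exact ⟨fun _ => (Option.some_ne_none _).symm, fun _ => ⟨_, Γ.leafMap_flip⟩⟩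
      · exact ⟨fun _ => (Option.some_ne_none _).symm, fun _ => ⟨_, Γ.leafMap_self⟩⟩)
    (by
      rintro (_ | v)
      · exact ⟨fun _ => (Option.some_ne_none _).symm, fun _ => ⟨_, if_pos rfl⟩⟩
      · refine Iff.trans ⟨?_, fun hz => ⟨v, if_neg hz⟩⟩ (Option.some_injective _).ne_iff.symm
        rintro ⟨u, hu⟩
        split_ifs at hu with h3
        rwa [← Option.some_injective _ hu])
    (by
      rintro (_ | v)
      · exact ⟨fun _ => (Option.some_ne_none _).symm, fun _ => ⟨_, if_pos rfl⟩⟩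
      · refine Iff.trans ⟨?_, fun hz => ⟨v, if_neg hz⟩⟩ (Option.some_injective _).ne_iff.symm
        rintro ⟨u, hu⟩
        split_ifs at hu with h3
        rwa [← Option.some_injective _ hu])
    (fun z hz => by
      change Γ.H at z
      change (if Γ.φV z = _ then none else some (Γ.φV z)) = some (Γ.φV h)
      have hl : Γ.φV h ≠ Γ.φV (Γ.flip h) := Graph.ne_of_attach_contractible hc
      by_cases h1 : Γ.φE z = Γ.φE h
      · rcases Γ.eq_or_eq_flip h1 with rfl | rfl
        · exact if_neg hl
        · rw [Γ.leafMap_flip] at hz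
          exact (Option.some_ne_none _ hz.symm).elim
      · rw [Γ.leafMap_of_ne h1] at hz
        exact (h1 ((congrArg Γ.φE (hh z (Option.some_injective _ hz))).trans (Γ.φE_flip h))).elim)
    (fun z hz => by
      change Γ.H at z
      change (if Γ.φV z = _ then none else some (Γ.φV z)) = _
      have hl : Γ.φV h ≠ Γ.φV (Γ.flip h) := Graph.ne_of_attach_contractible hc
      by_cases h1 : Γ.φE z = Γ.φE h
      · rcases Γ.eq_or_eq_flip h1 with rfl | rfl
        · rw [Γ.leafMap_self] at hz ⊢
          rcases Γ.eq_or_eq_flip hx with rfl | rfl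
          · exact if_neg hl
          · exact (hz rfl).elim
        · rw [Γ.leafMap_flip]
          exact if_pos rfl
      · rw [Γ.leafMap_of_ne h1]
        exact if_neg fun h2 => h1 ((congrArg Γ.φE (hh z h2)).trans (Γ.φE_flip h)))
    (fun z => by
      change Γ.H at z
      change (Γ.attach x).φE (Γ.leafMap h z) = if Γ.φE z = Γ.φE h then none else some (Γ.φE z)
      change (Γ.attach x).φE (if _ then _ else _) = _
      split_ifs <;> rfl)
    (fun hr z => Γ.mergeCycles_leafMap hx (hh _ (((Γ.cyc hr).sameCycle_iff _ _).1
      (sameCycle_step _ _).symm)) z)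
    (Γ.extendH h (Classical.arbitrary _))
    (TotalOrdering.cons (Γ.φV (Γ.flip h)) (Classical.arbitrary _))
    (fun L W hL hW => by
      refine (Γ.orient.attach_sign_extend x h _ _ _ _
        (hL.trans (congrArg (fun z => _ :: _ :: z) (Γ.map_leafMap_extendH _)))
        (hW.trans (congrArg (fun z => _ :: z) ?_))).trans (neg_neg _).symm
      exact TotalOrdering.map_cons _ _)

end OGraph

namespace Graph

variable (Γ : Graph)

/-- One of the end points of the edge of `h` is univalent. -/
def Leafy (h : Γ.H) : Prop := Γ.Alone h ∨ Γ.Alone (Γ.flip h)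

/-- The number of half-edges of edges with a univalent end point. -/
def leafCount : ℕ := {h | Γ.Leafy h}.ncard

variable {Γ}

lemma leafy_iff_of_φE_eq {h z : Γ.H} (hz : Γ.φE z = Γ.φE h) : Γ.Leafy z ↔ Γ.Leafy h := by
  rcases Γ.eq_or_eq_flip hz with rfl | rfl
  · rfl
  · rw [Leafy, Leafy, Γ.flip_flip, or_comm]

lemma Alone.ne {h : Γ.H} (hh : Γ.Alone h) : Γ.φV h ≠ Γ.φV (Γ.flip h) := fun hl =>
  Γ.flip_ne h (hh _ hl.symm)

variable (Γ) in
lemma card_H : Nat.card Γ.H = 2 * Nat.card Γ.E := by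
  rw [Nat.card_eq_fintype_card, Nat.card_eq_fintype_card, ← Finset.card_univ,
    Finset.card_eq_sum_card_fiberwise (f := Γ.φE) (t := Finset.univ) (by simp),
    Finset.sum_const_nat (m := 2), mul_comm, Finset.card_univ]
  intro e _
  rw [← Γ.φE_fiber e, Set.ncard_eq_toFinset_card']
  congr 1
  ext z
  simp

lemma card_V_le (hv : ∀ v, 2 ≤ Γ.valence v) : Nat.card Γ.V ≤ Nat.card Γ.E := by
  have h1 : Nat.card Γ.V * 2 ≤ Nat.card Γ.H := by
    rw [Nat.card_eq_fintype_card, Nat.card_eq_fintype_card, ← Finset.card_univ (α := Γ.H),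
      Finset.card_eq_sum_card_fiberwise (f := Γ.φV) (t := Finset.univ) (by simp),
      ← Finset.card_univ, ← smul_eq_mul]
    refine Finset.card_nsmul_le_sum _ _ _ fun v _ => (hv v).trans_eq ?_
    rw [valence, Set.ncard_eq_toFinset_card']
    congr 1
    ext z
    simp
  rw [card_H] at h1
  omega

/-- A graph all of whose edges have a univalent end point has more vertices than edges. -/
lemma card_E_lt_of_leafy (h : ∀ z, Γ.Leafy z) : Nat.card Γ.E < Nat.card Γ.V := by
  have h1 : ∀ e : Γ.E, ∃ z, Γ.φE z = e ∧ Γ.Alone z := fun e => by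
    obtain ⟨z, rfl⟩ := Γ.φE_surj e
    rcases h z with hz | hz
    · exact ⟨z, rfl, hz⟩
    · exact ⟨Γ.flip z, Γ.φE_flip z, hz⟩
  choose f hf hf' using h1
  have inj : Function.Injective fun e => Γ.φV (f e) := fun a b hab => by
    rw [← hf a, ← hf b, hf' b _ hab]
  by_contra! hle
  have surj := (inj.bijective_of_nat_card_le hle).2
  have injV : Function.Injective Γ.φV := fun a b hab => by
    obtain ⟨e, he⟩ := surj (Γ.φV a)
    rw [hf' e a he.symm, hf' e b (hab.symm.trans he.symm)]
  have h2 := Nat.card_le_card_of_injective _ injV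
  rw [card_H] at h2
  obtain ⟨v⟩ := Γ.nonempty_V
  have h3 : 0 < Nat.card Γ.V := Nat.card_pos_iff.2 ⟨⟨v⟩, inferInstance⟩
  omega

lemma card_contract_V (h : Γ.H) (hc : Γ.Contractible h) :
    Nat.card (Γ.contract h hc).V + 1 = Nat.card Γ.V := by
  have h1 : Nat.card (Γ.contract h hc).V = Nat.card {v : Γ.V // v ≠ Γ.φV (Γ.flip h)} := rfl
  have h3 : 0 < Nat.card Γ.V := Nat.card_pos_iff.2 ⟨⟨Γ.φV h⟩, inferInstance⟩
  rw [h1, Nat.card_eq_fintype_card, Fintype.card_subtype_compl, Fintype.card_subtype_eq,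
    ← Nat.card_eq_fintype_card]
  omega

section

variable {x : Γ.H} (hc : (Γ.attach x).Contractible (Sum.inl x))

lemma alone_attach_contract {z : Γ.H} (hz : Γ.φE z ≠ Γ.φE x) (ha : Γ.Alone z)
    (w : ((Γ.attach x).contract (Sum.inl x) hc).H) (hw : (w : (Γ.attach x).RestH (Sum.inl x)).1 =
      (Sum.inl z : Γ.H ⊕ Bool)) : ((Γ.attach x).contract (Sum.inl x) hc).Alone w := by
  obtain ⟨_, hw'⟩ := w
  subst hw
  have hx : Γ.φV x ≠ Γ.φV z := fun h => hz (congrArg Γ.φE (ha _ h)).symm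
  have hx' : Γ.φV (Γ.flip x) ≠ Γ.φV z := fun h => hz (by rw [← ha _ h, φE_flip])
  rintro ⟨u, hu⟩ huv
  apply Subtype.ext
  have h1 : ((Γ.attach x).merge (Sum.inl x) hc.1 ((Γ.attach x).φV u)).1 =
      ((Γ.attach x).merge (Sum.inl x) hc.1 (some (Γ.φV z))).1 := congrArg Subtype.val huv
  rw [merge_val, merge_val, attach_flip_inl] at h1
  have h2 : (some (Γ.φV z) : (Γ.attach x).V) ≠ (Γ.attach x).φV (Sum.inl (Γ.flip x)) :=
    fun h => hx' (Option.some_injective _ h).symm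
  rw [if_neg h2] at h1
  split_ifs at h1 with h3
  · exact (hx (Option.some_injective _ h1)).elim
  · rcases u with u | _ | _
    · exact congrArg Sum.inl (ha _ (Option.some_injective _ h1))
    · exact (Option.some_ne_none _ h1.symm).elim
    · exact (hx (Option.some_injective _ h1)).elim

lemma leafCount_lt (hx : ¬ Γ.Leafy x) :
    Γ.leafCount < ((Γ.attach x).contract (Sum.inl x) hc).leafCount := by
  set C := (Γ.attach x).contract (Sum.inl x) hc
  set e : C.H → Γ.H ⊕ Bool := (Subtype.val : (Γ.attach x).RestH (Sum.inl x) → Γ.H ⊕ Bool) with he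
  have inj : Function.Injective e := Subtype.val_injective
  have hsub : insert (Sum.inr false) (Sum.inl '' {h | Γ.Leafy h}) ⊆ e '' {h | C.Leafy h} := by
    rintro _ (rfl | ⟨z, hz, rfl⟩)
    · refine ⟨(⟨Sum.inr false, (Option.some_ne_none _).symm⟩ : (Γ.attach x).RestH (Sum.inl x)),
        Or.inl ?_, rfl⟩
      rintro ⟨u, hu⟩ huv
      apply Subtype.ext
      have h1 : ((Γ.attach x).merge (Sum.inl x) hc.1 ((Γ.attach x).φV u)).1 =
        ((Γ.attach x).merge (Sum.inl x) hc.1 none).1 := congrArg Subtype.val huv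
      rw [merge_val, merge_val, attach_flip_inl] at h1
      have h2 : (none : (Γ.attach x).V) ≠ (Γ.attach x).φV (Sum.inl (Γ.flip x)) :=
        (Option.some_ne_none _).symm
      rw [if_neg h2] at h1
      split_ifs at h1 with h3
      · exact (Option.some_ne_none _ h1).elim
      · rcases u with u | _ | _
        · exact (Option.some_ne_none _ h1).elim
        · rfl
        · exact (Option.some_ne_none _ h1).elim
    · have hzx : Γ.φE z ≠ Γ.φE x := fun h => hx ((leafy_iff_of_φE_eq h).1 hz)
      refine ⟨(⟨Sum.inl z, fun h => hzx (Option.some_injective _ h)⟩ :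
        (Γ.attach x).RestH (Sum.inl x)), ?_, rfl⟩
      refine hz.imp (fun h => alone_attach_contract hc hzx h _ rfl) fun h =>
        alone_attach_contract hc (z := Γ.flip z) (by rwa [φE_flip]) h _ ?_
      rw [contract_flip]
      exact Γ.attach_flip_inl x z
  have h1 := Set.ncard_le_ncard hsub (Set.toFinite _)
  rw [Set.ncard_insert_of_notMem (by simp), Set.ncard_image_of_injective _ Sum.inl_injective,
    Set.ncard_image_of_injective _ inj] at h1
  exact h1

end

end Graph

variable (K : Type*) [Field K] {k : Kind}

/-- The sum of all the graphs obtained by attaching a hair. -/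
def attachSum {m : ℕ} (Γ : OGraph k) (hm : Nat.card Γ.E = m) : Chain K k (m + 1) :=
  ∑ x : Γ.H, cls K (Γ.attach x) (Γ.card_attach x hm)

lemma attachSum_iso {m : ℕ} {Γ Δ : OGraph k} (i : OGraph.Iso Γ Δ) (hm : Nat.card Γ.E = m)
    (hm' : Nat.card Δ.E = m) : attachSum K Γ hm = attachSum K Δ hm' :=
  Fintype.sum_equiv i.onH _ _ fun x => cls_iso K (i.attach x) _ _

lemma attachSum_opp {m : ℕ} (Γ : OGraph k) (hm : Nat.card Γ.E = m)
    (hm' : Nat.card Γ.opp.E = m) : attachSum K Γ.opp hm' = -attachSum K Γ hm := by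
  unfold attachSum
  rw [← Finset.sum_neg_distrib]
  refine Finset.sum_congr rfl fun x _ => ?_
  exact (cls_iso K (OGraph.Iso.attachOpp Γ x) _ (Γ.card_attach x hm)).trans
    (cls_opp K (Γ.attach x) (Γ.card_attach x hm) _)

variable (k) in
/-- The linear map which attaches hairs in all possible ways. -/
def hairMap (m : ℕ) : Chain K k m →ₗ[K] Chain K k (m + 1) :=
  (relations K k m).liftQ (Finsupp.linearCombination K fun Γ => attachSum K Γ.1 Γ.2) <| by
    rw [relations, Submodule.span_le]
    rintro z (⟨Γ, Δ, ⟨i⟩, rfl⟩ | ⟨Γ, rfl⟩)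
    · simp only [SetLike.mem_coe, LinearMap.mem_ker, map_sub, Finsupp.linearCombination_single,
        one_smul]
      rw [attachSum_iso K i Γ.2 Δ.2, sub_self]
    · simp only [SetLike.mem_coe, LinearMap.mem_ker, map_add, Finsupp.linearCombination_single,
        one_smul]
      rw [attachSum_opp K Γ.1 Γ.2, add_neg_cancel]

lemma hairMap_cls {m : ℕ} (Γ : OGraph k) (hm : Nat.card Γ.E = m) :
    hairMap K k m (cls K Γ hm) = attachSum K Γ hm := by
  simp [hairMap, cls]

lemma boundary_attach {m : ℕ} (Γ : OGraph k) (hm : Nat.card Γ.E = m) (x : Γ.H) :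
    boundary K (Γ.attach x) (Γ.card_attach x hm) = cls K Γ hm +
      ∑ e : Γ.E, contractCls K (Γ.attach x) (Γ.card_attach x hm) (Sum.inl (Γ.half e)) := by
  have h1 : boundary K (Γ.attach x) (Γ.card_attach x hm) = ∑ e : Option Γ.E,
      contractCls K (Γ.attach x) (Γ.card_attach x hm) ((Γ.attach x).half e) :=
    @Fintype.sum_equiv _ _ _ (_) (_) _ (Equiv.refl _) _ _ fun _ => rfl
  rw [h1, Fintype.sum_option]
  congr 1
  · rw [contractCls_edge K (Γ.attach x) _ (h := Sum.inr true) ((Γ.attach x).φE_half none),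
      contractCls_pos K _ _ (Γ.attach_contractible_hair x)]
    exact (cls_iso K (OGraph.Iso.contractHair Γ x _) _ _).symm
  · refine Finset.sum_congr rfl fun e _ => contractCls_edge K _ _ ?_
    exact ((Γ.attach x).φE_half (some e)).trans (congrArg some (Γ.φE_half e).symm)

lemma sum_contractCls_attach {m : ℕ} (Γ : OGraph k) (hm : Nat.card Γ.E = m + 1) (h : Γ.H) :
    ∑ x : Γ.H with ¬ Γ.φE x = Γ.φE h,
        contractCls K (Γ.attach x) (Γ.card_attach x hm) (Sum.inl h) =
      -hairMap K k m (contractCls K Γ hm h) := by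
  by_cases hc : Γ.Contractible h
  · rw [contractCls_pos K _ _ hc, hairMap_cls, attachSum, ← Finset.sum_neg_distrib]
    refine (Finset.sum_subtype (F := Fintype.ofFinite _) (p := fun x => Γ.φE x ≠ Γ.φE h) _
      (by simp) _).trans ?_
    refine @Fintype.sum_equiv _ _ _ (_) (_) _ (Equiv.refl (Γ.RestH h)) _ _ fun y => ?_
    have hc' := (Graph.attach_contractible_iff y.2).2 hc
    rw [contractCls_pos K _ _ hc']
    exact (cls_iso K (OGraph.Iso.attachContract Γ h hc y hc')
      ((Γ.contract h hc).card_attach y (Γ.card_contract h hc hm)) _).symm.trans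
      (cls_opp K ((Γ.contract h hc).attach y) _ _)
  · rw [contractCls_neg K _ _ hc, map_zero, neg_zero]
    refine Finset.sum_eq_zero fun x hx => contractCls_neg K _ _ fun h' => hc ?_
    exact (Graph.attach_contractible_iff (by simpa using hx)).1 h'

/-- Attaching hairs is a homotopy up to contractions of edges with an adjacent hair. -/
lemma dChain_hairMap {m : ℕ} (Γ : OGraph k) (hm : Nat.card Γ.E = m + 1) :
    dChain K k (m + 1) (hairMap K k (m + 1) (cls K Γ hm)) +
        hairMap K k m (dChain K k m (cls K Γ hm)) =
      ∑ x : Γ.H, (cls K Γ hm +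
        contractCls K (Γ.attach x) (Γ.card_attach x hm) (Sum.inl x)) := by
  rw [hairMap_cls, attachSum, map_sum, dChain_cls, boundary, map_sum]
  rw [Finset.sum_congr rfl fun x _ => (dChain_cls K (Γ.attach x) (Γ.card_attach x hm)).trans
    (boundary_attach K Γ hm x), Finset.sum_add_distrib, Finset.sum_add_distrib, add_assoc, Finset.sum_comm, ← Finset.sum_add_distrib]
  congr 1
  rw [← Finset.sum_fiberwise _ Γ.φE]
  refine Finset.sum_congr rfl fun e _ => ?_
  rw [← neg_neg (hairMap K k m _), ← sum_contractCls_attach, ← sub_eq_add_neg, sub_eq_iff_eq_add,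
    ← Finset.sum_filter_add_sum_filter_not _ (fun x => Γ.φE x = Γ.φE (Γ.half e))]
  congr 1
  rw [Γ.φE_half]
  refine Finset.sum_congr rfl fun x hx => contractCls_edge K _ _ ?_
  exact congrArg some ((Γ.φE_half e).trans (Finset.mem_filter.1 hx).2.symm)

lemma contractCls_attach_leafy {m : ℕ} (Γ : OGraph k) (hm : Nat.card Γ.E = m) {x : Γ.H}
    (hx : Γ.Leafy x) :
    contractCls K (Γ.attach x) (Γ.card_attach x hm) (Sum.inl x) = -cls K Γ hm := by
  have key : ∀ h : Γ.H, Γ.φE x = Γ.φE h → Γ.Alone (Γ.flip h) →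
      contractCls K (Γ.attach x) (Γ.card_attach x hm) (Sum.inl x) = -cls K Γ hm := by
    intro h hxh ha
    have hc := Graph.attach_contractible_self hxh (by simpa [Γ.flip_flip] using ha.ne.symm)
    rw [contractCls_edge K (Γ.attach x) _ (h' := Sum.inl x) (h := Sum.inl h) (congrArg some hxh),
      contractCls_pos K _ _ hc, ← cls_opp K Γ hm hm]
    exact (cls_iso K (OGraph.Iso.contractLeaf Γ x h hxh ha hc) _ _).symm
  rcases hx with hx | hx
  · exact key (Γ.flip x) (Γ.φE_flip x).symm (by rwa [Γ.flip_flip])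
  · exact key x rfl hx

variable (k) in
/-- The span of the graphs with at most as many vertices as edges and with at least `q` half-edges
of edges with a univalent end point. -/
def leafFiltration (m q : ℕ) : Submodule K (Chain K k m) :=
  Submodule.span K {z | ∃ (Γ : OGraph k) (hm : Nat.card Γ.E = m),
    Nat.card Γ.V ≤ m ∧ q ≤ Γ.leafCount ∧ z = cls K Γ hm}

lemma contractCls_attach_mem {m : ℕ} (Γ : OGraph k) (hm : Nat.card Γ.E = m)
    (hV : Nat.card Γ.V ≤ m) {x : Γ.H} (hx : ¬ Γ.Leafy x) {q : ℕ} (hq : q ≤ Γ.leafCount) :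
    contractCls K (Γ.attach x) (Γ.card_attach x hm) (Sum.inl x) ∈
      leafFiltration K k m (q + 1) := by
  by_cases hc : (Γ.attach x).Contractible (Sum.inl x)
  · rw [contractCls_pos K _ _ hc]
    refine Submodule.subset_span ⟨_, _, ?_, ?_, rfl⟩
    · have h1 : Nat.card ((Γ.attach x).contract (Sum.inl x) hc).V + 1 = Nat.card Γ.V + 1 :=
        ((Γ.attach x).card_contract_V _ hc).trans Finite.card_option
      omega
    · have h1 : Γ.leafCount < ((Γ.attach x).contract (Sum.inl x) hc).leafCount :=
        Graph.leafCount_lt hc hx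
      omega
  · rw [contractCls_neg K _ _ hc]
    exact Submodule.zero_mem _

lemma homotopy_mem {m q : ℕ} {z : Chain K k (m + 1)} (hz : z ∈ leafFiltration K k (m + 1) q) :
    dChain K k (m + 1) (hairMap K k (m + 1) z) + hairMap K k m (dChain K k m z) -
        ((2 * (m + 1) : ℕ) - q : K) • z ∈ leafFiltration K k (m + 1) (q + 1) := by
  induction hz using Submodule.span_induction with
  | mem z hz =>
    obtain ⟨Γ, hm, hV, hq, rfl⟩ := hz
    have hcount : Γ.leafCount + (Finset.univ.filter fun x => ¬ Γ.Leafy x).card =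
        2 * (m + 1) := by
      rw [← hm, ← Γ.card_H, Nat.card_eq_fintype_card, ← Finset.card_univ,
        ← Finset.card_filter_add_card_filter_not (s := Finset.univ) (fun x => Γ.Leafy x),
        Graph.leafCount, Set.ncard_eq_toFinset_card']
      congr 2
      ext x
      simp
    rw [dChain_hairMap, ← Finset.sum_filter_add_sum_filter_not _ (fun x => Γ.Leafy x),
      Finset.sum_eq_zero (s := Finset.univ.filter fun x => Γ.Leafy x) (fun x hx => by
        rw [contractCls_attach_leafy K Γ hm (Finset.mem_filter.1 hx).2, add_neg_cancel]),
      zero_add, Finset.sum_add_distrib, Finset.sum_const, add_sub_right_comm]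
    refine Submodule.add_mem _ ?_ (Submodule.sum_mem _ fun x hx =>
      contractCls_attach_mem K Γ hm hV (Finset.mem_filter.1 hx).2 hq)
    rw [← Nat.cast_smul_eq_nsmul K, ← sub_smul]
    rcases hq.eq_or_lt with h | h
    · have : ((Finset.univ.filter fun x => ¬ Γ.Leafy x).card : K) =
          (2 * (m + 1) : ℕ) - (q : K) := by
        rw [← hcount, h]
        push_cast
        ring
      rw [this, sub_self, zero_smul]
      exact Submodule.zero_mem _
    · exact Submodule.smul_mem _ _ (Submodule.subset_span ⟨Γ, hm, hV, h, rfl⟩)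
  | zero => simp
  | add z w _ _ hz hw =>
    simp only [map_add, smul_add]
    convert Submodule.add_mem _ hz hw using 1
    abel
  | smul c z _ hz =>
    convert Submodule.smul_mem _ c hz using 1
    simp only [map_smul, smul_sub, smul_add]
    rw [smul_comm]

lemma leafFiltration_eq_bot {m q : ℕ} (hq : 2 * m ≤ q) : leafFiltration K k m q = ⊥ := by
  rw [leafFiltration, Submodule.span_eq_bot]
  rintro _ ⟨Γ, hm, hV, hq', rfl⟩
  refine absurd (Graph.card_E_lt_of_leafy (Γ := Γ.toGraph) fun z => ?_) (by omega)
  have h1 : {h | Γ.Leafy h} = Set.univ := by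
    refine Set.eq_of_subset_of_ncard_le (Set.subset_univ _) ?_ (Set.toFinite _)
    rw [Set.ncard_univ, Γ.card_H, hm]
    exact hq.trans hq'
  exact h1.ge (Set.mem_univ z)

/-- Every cycle in the span of the graphs with at most as many vertices as edges is a boundary. -/
lemma exists_dChain_eq [CharZero K] {m q : ℕ} (z : Chain K k (m + 1))
    (hz : z ∈ leafFiltration K k (m + 1) q) (hd : dChain K k m z = 0) :
    ∃ y, dChain K k (m + 1) y = z := by
  rcases le_or_gt (2 * (m + 1)) q with hq | hq
  · rw [leafFiltration_eq_bot K hq, Submodule.mem_bot] at hz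
    exact ⟨0, by rw [hz, map_zero]⟩
  · set c : K := (2 * (m + 1) : ℕ) - q with hc
    have hc0 : c ≠ 0 := sub_ne_zero.2 (by exact_mod_cast hq.ne')
    have h1 := homotopy_mem K hz
    rw [hd, map_zero, add_zero] at h1
    obtain ⟨y, hy⟩ := exists_dChain_eq _ h1 (by
      rw [map_sub, map_smul, hd, dChain_dChain, smul_zero, sub_zero])
    refine ⟨c⁻¹ • (hairMap K k (m + 1) z - y), ?_⟩
    rw [map_smul, map_sub, hy, sub_sub_cancel, smul_smul, inv_mul_cancel₀ hc0, one_smul]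
termination_by 2 * (m + 1) - q

lemma uncurvedChain_le (m : ℕ) : uncurvedChain K k m ≤ leafFiltration K k m 0 := by
  refine Submodule.span_mono ?_
  rintro _ ⟨Γ, hm, hv, rfl⟩
  exact ⟨Γ, hm, (Graph.card_V_le hv).trans_eq hm, Nat.zero_le _, rfl⟩

lemma chain_zero_eq_zero (z : Chain K k 0) : z = 0 := by
  refine chain_induction K (p := fun z => z = 0) z rfl
    (fun x y hx hy => by rw [hx, hy, add_zero]) (fun c x hx => by rw [hx, smul_zero]) fun Γ hm => ?_
  obtain ⟨v⟩ := Γ.nonempty_V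
  obtain ⟨h, -⟩ := Γ.φV_surj v
  exact absurd hm (Nat.card_pos_iff.2 ⟨⟨Γ.φE h⟩, inferInstance⟩).ne'

variable (k) in
theorem inclusionOnHomology_eq_zero [CharZero K] : inclusionOnHomology K k = 0 := by
  ext ⟨x, hx⟩
  refine (Submodule.Quotient.mk_eq_zero _).2 ?_
  have hx' : diffUncurved K k x = 0 := hx
  have hd : ∀ m, dChain K k m (x.1 (m + 1)) = 0 := fun m =>
    congrFun (congrArg Subtype.val hx') m
  have hy : ∀ m, ∃ y : Chain K k (m + 1), dChain K k m y = x.1 m := by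
    rintro (_ | m)
    · exact ⟨0, by rw [map_zero, chain_zero_eq_zero K (x.1 0)]⟩
    · exact exists_dChain_eq K _ (uncurvedChain_le K _ (x.2 _)) (hd m)
  choose y hy using hy
  refine ⟨fun m => match m with
    | 0 => 0
    | m + 1 => y m, ?_⟩
  exact funext hy

end

end CurvedGraph

theorem corollary3p8 (K : Type*) [Field K] [CharZero K] :
    CurvedGraph.inclusionOnHomology K CurvedGraph.Kind.ribbon = 0 ∧
      CurvedGraph.inclusionOnHomology K CurvedGraph.Kind.commutative = 0 :=
  ⟨CurvedGraph.inclusionOnHomology_eq_zero K _, CurvedGraph.inclusionOnHomology_eq_zero K _⟩
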